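/- Let $(\mathbf I,\Omega,{}',{}'')$ be a finite oriented graph (loops and multiple edges allowed; $h'$ and $h''$ are the source and target of the edge $h$) with an admissible automorphism $a$: compatible bijections of $\mathbf I$ and $\Omega$ such that no edge $h$ with $h'\ne h''$ has both ends in one $a$-orbit of vertices. For a vertex $i$ let $[i]$ be its orbit and $I=\mathbf I/a$. Let $e\in\Omega$, $[i_+]=[e']$, $[i_-]=[e'']$, and assume: (1) $\#[i_+]=\#[i_-]=:\phi$; (2) if $h',h''\in[i_+]\cup[i_-]$ and $h'\neq h''$, there is no edge $l$ with $l',l''\in[i_+]\cup[i_-]$, $l'\in\{h',h''\}$ and $l''\notin\{h',h''\}$; (3) there are no loops at vertices of $[i_+]\cup[i_-]$; (4) $a^{\phi}(e)=e$. Several edges may join $[i_+]$ and $[i_-]$. Put $h_k=a^k(e)$ for $1\le k\le\phi$. The contracted graph has vertex set $\widehat{\mathbf I}=\mathbf I\setminus[i_-]$ and as edges: the edges of $\Omega$ with no end in $[i_-]$; an edge $l h_k$ from $h_k'$ to $l''$ for each edge $l$ with $l'=h_k''$; and an edge $\overline{h_k}\,l$ from $l'$ to $h_k'$ for each edge $l\ne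 h_k$ with $l''=h_k''$. It carries the admissible automorphism induced by $a$. Let $\widehat I$ be its set of orbits of vertices; write $i_0\in\widehat I$ for the orbit $[i_+]$, and embed $\mathbb N[\widehat I]$ into $\mathbb N[I]$ by $i_0\mapsto i_++i_-$. Let $q=p^n$ with $p$ prime and $n\ge1$, $K=\overline{\mathbb F}_p$, and fix $q^{1/2}\in\mathbb C$ with square $q$. For $\nu\in\mathbb N[I]$ let $V_i=K^{\nu_{[i]}}$, $E_\nu=\bigoplus_{h\in\Omega}\operatorname{Hom}(V_{h'},V_{h''})$, $G_\nu=\prod_{i\in\mathbf I} GL(V_i)$, acting by $(g.x)_h=g_{h''}x_hg_{h'}^{-1}$, and let $F$ be the twisted Frobenius on these: $F(x)_h$ is $x_{a(h)}$, and $F(g)_i$ is $g_{a(i)}$, with all entries raised to the power $q$. Let $\mathbf H_\nu$ be the space of $G_\nu^F$-invariant functions $E_\nu^F\to\mathbb Q(q^{1/2})$, and let $\mathbf H_\Omega=\bigoplus_{\nu\in\mathbb N[I]}\mathbf H_\nu$ be the Hall algebra, with multiplication given for $f_1\in\mathbf H_\tau$, $f_2\in\mathbf H_\omega$ by $$f_1\circ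 f_2=(q^{1/2})^{-m_\Omega(\tau,\omega)}\,\frac{1}{\#(G_\tau^F\times G_\omega^F)}\,(p_3)_!(p_2)_!(p_1)^*(f_1\otimes f_2)\in\mathbf H_{\tau+\omega},\qquad m_\Omega(\tau,\omega)=\sum_{i\in\mathbf I}\tau_i\omega_i+\sum_{h\in\Omega}\tau_{h'}\omega_{h''}.$$ Here $E_\tau^F\times E_\omega^F\xleftarrow{p_1}E'^F\xrightarrow{p_2}E''^F\xrightarrow{p_3}E_{\tau+\omega}^F$ is the $F$-fixed part of Lusztig's induction diagram: writing $V=T\oplus W$ with $T,W$ of dimension vectors $\tau,\omega$, let $S_W\subseteq E_{\tau+\omega}$ be the set of $x$ that leave $W$ invariant; $E'$ and $E''$ are the sets of orbits in $G_{\tau+\omega}\times S_W$ of the unipotent radical of the stabilizer of $W$ and of that stabilizer itself, acting by $b.(g,x)=(gb^{-1},b.x)$; $p_1[g,x]=(x|_{V/W},x|_W)$, $p_2[g,x]=[g,x]$, $p_3[g,x]=g.x$; and $\phi_!$ is summation over the fibres of $\phi$. The unit is the function $1\in\mathbf H_0$. Let $\mathbf H_{\widehat\Omega}=\bigoplus_{\nu\in\mathbb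 N[\widehat I]}\mathbf H_{\nu,\widehat\Omega}$ be the Hall algebra of the contracted graph. For $\nu\in\mathbb N[\widehat I]\subseteq\mathbb N[I]$ let $E_\nu^{\heartsuit}\subseteq E_\nu$ be the set of $x$ with all $x_{h_k}$ isomorphisms, and let $\mu_\nu:E_\nu^{\heartsuit,F}\to\widehat E_\nu^{F}$ be the contraction map $\widehat x_h=x_h$, $\widehat x_{l h_k}=x_lx_{h_k}$, $\widehat x_{\overline{h_k}l}=x_{h_k}^{-1}x_l$. Let $\mathbf H^{\heartsuit}_\Omega$ be the direct sum over $\nu\in\mathbb N[\widehat I]$ of the spaces of $G_\nu^F$-invariant functions $E_\nu^{\heartsuit,F}\to\mathbb Q(q^{1/2})$. Let $\mu^\star:\mathbf H_{\widehat\Omega}\to\mathbf H^{\heartsuit}_\Omega$ be given on the $\nu$-component by $\mu_\nu^\star(f)=(q^{-1/2})^{\nu_{i_-}^2\phi}\,f\circ\mu_\nu$, and let $j_!:\mathbf H^{\heartsuit}_\Omega\to\mathbf H_\Omega$ be extension by zero. Then $\psi=j_!\circ\mu^\star:\mathbf H_{\widehat\Omega}\to\mathbf H_\Omega$ is an injective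 homomorphism of algebras over $\mathbb Q(q^{1/2})$: it is linear and injective, $\psi(1)=1$, and $\psi(f\circ g)=\psi(f)\circ\psi(g)$ for all $f,g$. -/

import Mathlib

open scoped DirectSum

noncomputable section

set_option linter.unusedSectionVars false

namespace HallContraction

/-! ### Oriented graphs with an admissible automorphism -/

/-- An oriented graph with vertex set `ι` and edge set `Ω` (loops and multiple edges are allowed),
`src h = h'`, `tgt h = h''`, together with an admissible automorphism `a = (aV, aE)`: an edge that
is not a loop never has both its ends in one `a`-orbit of vertices. -/
structure AdmissibleQuiver (ι Ω : Type*) where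
  src : Ω → ι
  tgt : Ω → ι
  aV : Equiv.Perm ι
  aE : Equiv.Perm Ω
  src_aE : ∀ h, src (aE h) = aV (src h)
  tgt_aE : ∀ h, tgt (aE h) = aV (tgt h)
  admissible : ∀ h, src h ≠ tgt h → ¬ aV.SameCycle (src h) (tgt h)

namespace AdmissibleQuiver

variable {ι Ω : Type*} (Q : AdmissibleQuiver ι Ω)

/-- The `a`-orbit `[i]` of a vertex. -/
def orbit (i : ι) : Set ι := {j | Q.aV.SameCycle i j}

/-- The number of vertices of the orbit `[i]`. -/
def φ₁ (i : ι) : ℕ := Nat.card (Q.orbit i)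

/-- The number of loops at `i`; it depends only on the orbit of `i`. -/
def φ₂ (i : ι) : ℕ := Nat.card {h : Ω // Q.src h = i ∧ Q.tgt h = i}

/-- The set `I` of `a`-orbits of vertices. -/
def Orb : Type _ := Quotient (Equiv.Perm.SameCycle.setoid Q.aV)

/-- The orbit of `i` as an element of `I`. -/
def orb (i : ι) : Q.Orb := Quotient.mk (Equiv.Perm.SameCycle.setoid Q.aV) i

/-- Dimension vectors, the elements of `ℕ[I]`. -/
abbrev Dim : Type _ := Q.Orb → ℕ

/-- `e` is an edge along whose orbit one can contract: with `[i₊] = [e']` and `[i₋] = [e'']`, the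
two orbits have the same size, they carry no loops, the edges inside `[i₊] ∪ [i₋]` only join
matched vertices, and the edges `h_k = a^k(e)`, `1 ≤ k ≤ φ₁(i₊)`, form an orbit of `a` (so that
`a` acts on the contracted graph). -/
structure IsContractible (e : Ω) : Prop where
  card_eq : Q.φ₁ (Q.src e) = Q.φ₁ (Q.tgt e)
  matched : ∀ h : Ω, Q.src h ∈ Q.orbit (Q.src e) ∪ Q.orbit (Q.tgt e) →
    Q.tgt h ∈ Q.orbit (Q.src e) ∪ Q.orbit (Q.tgt e) → Q.src h ≠ Q.tgt h →
    ¬ ∃ l : Ω, Q.src l ∈ Q.orbit (Q.src e) ∪ Q.orbit (Q.tgt e) ∧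
      Q.tgt l ∈ Q.orbit (Q.src e) ∪ Q.orbit (Q.tgt e) ∧
      (Q.src l = Q.src h ∨ Q.src l = Q.tgt h) ∧ ¬ (Q.tgt l = Q.src h ∨ Q.tgt l = Q.tgt h)
  loops_src : Q.φ₂ (Q.src e) = 0
  loops_tgt : Q.φ₂ (Q.tgt e) = 0
  pow_fix : (Q.aE ^ Q.φ₁ (Q.src e)) e = e

theorem src_zpow (k : ℤ) (h : Ω) : Q.src ((Q.aE ^ k) h) = (Q.aV ^ k) (Q.src h) := by
  induction k using Int.induction_on generalizing h with
  | zero => simp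
  | succ k ih => rw [zpow_add_one, zpow_add_one, Equiv.Perm.mul_apply, ih, Q.src_aE]; rfl
  | pred k ih =>
    rw [zpow_sub_one, zpow_sub_one, Equiv.Perm.mul_apply, ih, Equiv.Perm.mul_apply]
    congr 1
    rw [Equiv.Perm.eq_inv_iff_eq, ← Q.src_aE]; simp

theorem tgt_zpow (k : ℤ) (h : Ω) : Q.tgt ((Q.aE ^ k) h) = (Q.aV ^ k) (Q.tgt h) := by
  induction k using Int.induction_on generalizing h with
  | zero => simp
  | succ k ih => rw [zpow_add_one, zpow_add_one, Equiv.Perm.mul_apply, ih, Q.tgt_aE]; rfl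
  | pred k ih =>
    rw [zpow_sub_one, zpow_sub_one, Equiv.Perm.mul_apply, ih, Equiv.Perm.mul_apply]
    congr 1
    rw [Equiv.Perm.eq_inv_iff_eq, ← Q.tgt_aE]; simp

theorem orb_src_aE (h : Ω) : Q.orb (Q.src (Q.aE h)) = Q.orb (Q.src h) := by
  rw [Q.src_aE]
  exact Quotient.sound (Equiv.Perm.sameCycle_apply_left.2 (Equiv.Perm.SameCycle.refl _ _))

theorem orb_tgt_aE (h : Ω) : Q.orb (Q.tgt (Q.aE h)) = Q.orb (Q.tgt h) := by
  rw [Q.tgt_aE]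
  exact Quotient.sound (Equiv.Perm.sameCycle_apply_left.2 (Equiv.Perm.SameCycle.refl _ _))

theorem orb_aV (i : ι) : Q.orb (Q.aV i) = Q.orb i :=
  Quotient.sound (Equiv.Perm.sameCycle_apply_left.2 (Equiv.Perm.SameCycle.refl _ _))

/-! ### The contracted graph -/

theorem exists_leg (e : Ω) {i : ι} (hi : i ∈ Q.orbit (Q.tgt e)) :
    ∃ h, Q.aE.SameCycle e h ∧ Q.tgt h = i := by
  obtain ⟨k, hk⟩ := hi
  exact ⟨(Q.aE ^ k) e, ⟨k, rfl⟩, by rw [Q.tgt_zpow, hk]⟩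

/-- For `i ∈ [i₋]`, the contracted edge `h_k` with `h_k'' = i`. -/
def leg (e : Ω) {i : ι} (hi : i ∈ Q.orbit (Q.tgt e)) : Ω := (Q.exists_leg e hi).choose

theorem leg_sameCycle (e : Ω) {i : ι} (hi : i ∈ Q.orbit (Q.tgt e)) :
    Q.aE.SameCycle e (Q.leg e hi) := (Q.exists_leg e hi).choose_spec.1

theorem tgt_leg (e : Ω) {i : ι} (hi : i ∈ Q.orbit (Q.tgt e)) :
    Q.tgt (Q.leg e hi) = i := (Q.exists_leg e hi).choose_spec.2

/-- The vertices of the contracted graph: all vertices outside `[i₋]`. -/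
abbrev CVertex (e : Ω) : Type _ := {i : ι // i ∉ Q.orbit (Q.tgt e)}

/-- The edges of the contracted graph: all edges except the contracted ones `h_k`. An edge `l` with
no end in `[i₋]` is kept; one with `l' ∈ [i₋]` stands for `l h_k`, where `h_k'' = l'`; one with
`l'' ∈ [i₋]` stands for `h_k⁻¹ l`, where `h_k'' = l''`. -/
abbrev CEdge (e : Ω) : Type _ := {l : Ω // ¬ Q.aE.SameCycle e l}

section contraction

variable {Q}
variable [Finite ι] [Finite Ω] {e : Ω}

theorem src_ne_of_loops {i j : ι} (h0 : Q.φ₂ i = 0) (hj : j ∈ Q.orbit i) (h : Ω)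
    (hs : Q.src h = j) : Q.tgt h ≠ j := by
  intro ht
  obtain ⟨k, hk⟩ := hj
  have hE : IsEmpty {h : Ω // Q.src h = i ∧ Q.tgt h = i} := Finite.card_eq_zero_iff.1 h0
  refine hE.false ⟨(Q.aE ^ (-k)) h, ?_, ?_⟩
  · rw [Q.src_zpow, hs, ← hk, ← Equiv.Perm.mul_apply, ← zpow_add]; simp
  · rw [Q.tgt_zpow, ht, ← hk, ← Equiv.Perm.mul_apply, ← zpow_add]; simp

theorem IsContractible.src_ne_tgt (hC : Q.IsContractible e) {h : Ω} (hh : Q.aE.SameCycle e h) :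
    Q.src h ≠ Q.tgt h := by
  obtain ⟨k, rfl⟩ := hh
  have : Q.src ((Q.aE ^ k) e) ∈ Q.orbit (Q.src e) := ⟨k, (Q.src_zpow k e).symm⟩
  exact (src_ne_of_loops hC.loops_src this _ rfl).symm

theorem src_mem {h : Ω} (hh : Q.aE.SameCycle e h) : Q.src h ∈ Q.orbit (Q.src e) := by
  obtain ⟨k, rfl⟩ := hh
  exact ⟨k, (Q.src_zpow k e).symm⟩

theorem tgt_mem {h : Ω} (hh : Q.aE.SameCycle e h) : Q.tgt h ∈ Q.orbit (Q.tgt e) := by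
  obtain ⟨k, rfl⟩ := hh
  exact ⟨k, (Q.tgt_zpow k e).symm⟩

theorem IsContractible.disjoint (hC : Q.IsContractible e) {i : ι} (hi : i ∈ Q.orbit (Q.src e)) :
    i ∉ Q.orbit (Q.tgt e) := fun h =>
  Q.admissible e (hC.src_ne_tgt (Equiv.Perm.SameCycle.refl _ _)) (hi.trans h.symm)

theorem IsContractible.fix_of_tgt (hC : Q.IsContractible e) (k : ℤ)
    (hk : (Q.aV ^ k) (Q.tgt e) = Q.tgt e) : (Q.aE ^ k) e = e := by
  have hc : Q.φ₁ (Q.tgt e) = Function.minimalPeriod Q.aV (Q.tgt e) := by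
    have h1 : Q.orbit (Q.tgt e) = MulAction.orbit (Subgroup.zpowers Q.aV) (Q.tgt e) := by
      ext j
      constructor
      · rintro ⟨k, hk⟩
        exact ⟨⟨Q.aV ^ k, k, rfl⟩, hk⟩
      · rintro ⟨⟨_, k, rfl⟩, hk⟩
        exact ⟨k, hk⟩
    have := Fintype.ofFinite ι
    have : Fintype (MulAction.orbit (Subgroup.zpowers Q.aV) (Q.tgt e)) := Fintype.ofFinite _
    rw [φ₁, h1, Nat.card_eq_fintype_card, ← MulAction.minimalPeriod_eq_card]
    rfl
  have hd : (Q.φ₁ (Q.src e) : ℤ) ∣ k := by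
    rw [hC.card_eq, hc]
    exact (MulAction.zpow_smul_eq_iff_minimalPeriod_dvd (a := Q.aV) (b := Q.tgt e)).1 hk
  obtain ⟨m, rfl⟩ := hd
  have h2 : (Q.aE ^ (Q.φ₁ (Q.src e) : ℤ)) e = e := by
    rw [zpow_natCast]; exact hC.pow_fix
  rw [zpow_mul]
  exact Function.IsFixedPt.perm_zpow h2 m

theorem IsContractible.eq_of_tgt (hC : Q.IsContractible e) {h l : Ω} (hh : Q.aE.SameCycle e h)
    (hl : Q.aE.SameCycle e l) (ht : Q.tgt h = Q.tgt l) : h = l := by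
  obtain ⟨j, rfl⟩ := hh
  obtain ⟨k, rfl⟩ := hl
  rw [Q.tgt_zpow, Q.tgt_zpow] at ht
  have h1 : (Q.aV ^ (-k + j)) (Q.tgt e) = Q.tgt e := by
    rw [zpow_add, Equiv.Perm.mul_apply, ht, ← Equiv.Perm.mul_apply, ← zpow_add]; simp
  have h2 := hC.fix_of_tgt _ h1
  have h3 : (Q.aE ^ k) ((Q.aE ^ (-k + j)) e) = (Q.aE ^ k) e := by rw [h2]
  rw [← Equiv.Perm.mul_apply, ← zpow_add] at h3
  simpa using h3

open Classical in
/-- The map of vertices that identifies `h_k'' ∈ [i₋]` with `h_k' ∈ [i₊]`. -/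
def fold (hC : Q.IsContractible e) (i : ι) : Q.CVertex e :=
  if hi : i ∈ Q.orbit (Q.tgt e) then
    ⟨Q.src (Q.leg e hi), hC.disjoint (src_mem (Q.leg_sameCycle e hi))⟩
  else ⟨i, hi⟩

theorem fold_of_mem (hC : Q.IsContractible e) {i : ι} (hi : i ∈ Q.orbit (Q.tgt e)) :
    (fold hC i).1 = Q.src (Q.leg e hi) := by
  rw [fold, dif_pos hi]

theorem fold_of_notMem (hC : Q.IsContractible e) {i : ι} (hi : i ∉ Q.orbit (Q.tgt e)) :
    (fold hC i).1 = i := by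
  rw [fold, dif_neg hi]

theorem aV_mem_orbit {i j : ι} : Q.aV j ∈ Q.orbit i ↔ j ∈ Q.orbit i :=
  Equiv.Perm.sameCycle_apply_right

theorem IsContractible.leg_aV (hC : Q.IsContractible e) {i : ι} (hi : i ∈ Q.orbit (Q.tgt e))
    (hi' : Q.aV i ∈ Q.orbit (Q.tgt e)) : Q.leg e hi' = Q.aE (Q.leg e hi) := by
  refine hC.eq_of_tgt (Q.leg_sameCycle e hi')
    (Equiv.Perm.sameCycle_apply_right.2 (Q.leg_sameCycle e hi)) ?_
  rw [Q.tgt_leg, Q.tgt_aE, Q.tgt_leg]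

theorem fold_aV (hC : Q.IsContractible e) (i : ι) : (fold hC (Q.aV i)).1 = Q.aV (fold hC i).1 := by
  by_cases hi : i ∈ Q.orbit (Q.tgt e)
  · rw [fold_of_mem hC hi, fold_of_mem hC (aV_mem_orbit.2 hi), hC.leg_aV hi, Q.src_aE]
  · rw [fold_of_notMem hC hi, fold_of_notMem hC (fun h => hi (aV_mem_orbit.1 h))]

/-- The contracted graph with its admissible automorphism, the restriction of `a`. -/
def contract (hC : Q.IsContractible e) : AdmissibleQuiver (Q.CVertex e) (Q.CEdge e) where
  src l := fold hC (Q.src l.1)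
  tgt l := fold hC (Q.tgt l.1)
  aV := Q.aV.subtypePerm (fun _ => not_congr aV_mem_orbit)
  aE := Q.aE.subtypePerm (fun _ => not_congr Equiv.Perm.sameCycle_apply_right)
  src_aE l := Subtype.ext <| by
    show (fold hC (Q.src (Q.aE l.1))).1 = Q.aV (fold hC (Q.src l.1)).1
    rw [Q.src_aE, fold_aV]
  tgt_aE l := Subtype.ext <| by
    show (fold hC (Q.tgt (Q.aE l.1))).1 = Q.aV (fold hC (Q.tgt l.1)).1
    rw [Q.tgt_aE, fold_aV]
  admissible l hne hs := by
    rw [Equiv.Perm.sameCycle_subtypePerm] at hs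
    by_cases h1 : Q.src l.1 ∈ Q.orbit (Q.tgt e) <;> by_cases h2 : Q.tgt l.1 ∈ Q.orbit (Q.tgt e)
    · by_cases h3 : Q.src l.1 = Q.tgt l.1
      · exact hne (by rw [h3])
      · exact Q.admissible _ h3 (h1.symm.trans h2)
    · rw [fold_of_mem hC h1, fold_of_notMem hC h2] at hs
      have hk := Q.leg_sameCycle e h1
      refine hC.matched (Q.leg e h1) (Or.inl (src_mem hk)) (Or.inr (tgt_mem hk))
        (hC.src_ne_tgt hk) ⟨l.1, Or.inr h1, Or.inl ((src_mem hk).trans hs),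
          Or.inr (Q.tgt_leg e h1).symm, ?_⟩
      rintro (h | h)
      · exact hne (Subtype.ext (by rw [fold_of_mem hC h1, fold_of_notMem hC h2, h]))
      · exact h2 (h ▸ tgt_mem hk)
    · rw [fold_of_notMem hC h1, fold_of_mem hC h2] at hs
      have hk := Q.leg_sameCycle e h2
      have hl : Q.src l.1 ∈ Q.orbit (Q.src e) := (src_mem hk).trans hs.symm
      obtain ⟨m, hm⟩ := hl
      have hm' : Q.aE.SameCycle e ((Q.aE ^ m) e) := ⟨m, rfl⟩
      have hsm : Q.src l.1 = Q.src ((Q.aE ^ m) e) := by rw [Q.src_zpow, hm]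
      refine hC.matched ((Q.aE ^ m) e) (Or.inl (src_mem hm')) (Or.inr (tgt_mem hm'))
        (hC.src_ne_tgt hm') ⟨l.1, Or.inl (hsm ▸ src_mem hm'), Or.inr h2, Or.inl hsm, ?_⟩
      rintro (h | h)
      · exact hC.disjoint (h ▸ src_mem hm') h2
      · have := hC.eq_of_tgt hk hm' (by rw [Q.tgt_leg, h])
        exact hne (Subtype.ext (by rw [fold_of_notMem hC h1, fold_of_mem hC h2, this, hsm]))
    · rw [fold_of_notMem hC h1, fold_of_notMem hC h2] at hs
      refine Q.admissible _ (fun h => hne (by rw [h])) hs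

theorem fold_sameCycle (hC : Q.IsContractible e) (k : ℤ) (i : ι) :
    Q.aV.SameCycle (fold hC i).1 (fold hC ((Q.aV ^ k) i)).1 := by
  induction k using Int.induction_on generalizing i with
  | zero => exact Equiv.Perm.SameCycle.refl _ _
  | succ k ih =>
    have := ih (Q.aV i)
    rw [fold_aV, Equiv.Perm.sameCycle_apply_left] at this
    rwa [zpow_add_one]
  | pred k ih =>
    have := ih (Q.aV⁻¹ i)
    have h1 : Q.aV (Q.aV⁻¹ i) = i := by simp
    rw [← Equiv.Perm.sameCycle_apply_left, ← fold_aV, h1] at this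
    rwa [zpow_sub_one]

/-- The map `I → Î` of sets of orbits; it sends both `i₊` and `i₋` to `i₀`. -/
def foldOrb (hC : Q.IsContractible e) : Q.Orb → (contract hC).Orb :=
  Quotient.lift (fun i => (contract hC).orb (fold hC i)) fun i _ hij => by
    obtain ⟨k, rfl⟩ := hij
    exact Quotient.sound ((Equiv.Perm.sameCycle_subtypePerm (f := Q.aV)
      (p := fun i => i ∉ Q.orbit (Q.tgt e)) (h := fun _ => not_congr aV_mem_orbit)).2
        (fold_sameCycle hC k i))

/-- The inclusion `ℕ[Î] → ℕ[I]`, `i₀ ↦ i₊ + i₋`. -/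
def extDim (hC : Q.IsContractible e) (ν : (contract hC).Dim) : Q.Dim := fun i => ν (foldOrb hC i)

end contraction

/-! ### Representation spaces and the twisted Frobenius -/

/-- Renaming of the index sets of a matrix along equalities of their sizes. -/
def castM {K : Type*} {m n m' n' : ℕ} (hm : m' = m) (hn : n' = n)
    (A : Matrix (Fin m) (Fin n) K) : Matrix (Fin m') (Fin n') K :=
  A.submatrix (Fin.cast hm) (Fin.cast hn)

section castM

variable {K : Type*} [Field K]

theorem castM_mul {m n l m' n' l' : ℕ} (hm : m' = m) (hn : n' = n) (hl : l' = l)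
    (A : Matrix (Fin m) (Fin n) K) (B : Matrix (Fin n) (Fin l) K) :
    castM hm hl (A * B) = castM hm hn A * castM hn hl B := by
  subst hm hn hl; rfl

theorem castM_one {m m' : ℕ} (h h' : m' = m) :
    castM h h' (1 : Matrix (Fin m) (Fin m) K) = 1 := by
  subst h; rfl

theorem castM_inv {m m' : ℕ} (h h' : m' = m) (A : Matrix (Fin m) (Fin m) K) :
    castM h h' A⁻¹ = (castM h h' A)⁻¹ := by
  subst h; rfl

theorem castM_castM {m n m' n' m'' n'' : ℕ} (hm : m' = m) (hn : n' = n) (hm' : m'' = m')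
    (hn' : n'' = n') (A : Matrix (Fin m) (Fin n) K) :
    castM hm' hn' (castM hm hn A) = castM (hm'.trans hm) (hn'.trans hn) A := by
  subst hm hn hm' hn'; rfl

theorem castM_map {m n m' n' : ℕ} (hm : m' = m) (hn : n' = n) (A : Matrix (Fin m) (Fin n) K)
    (φ : K →+* K) : (castM hm hn A).map φ = castM hm hn (A.map φ) := rfl

theorem castM_self {m n : ℕ} (hm : m = m) (hn : n = n) (A : Matrix (Fin m) (Fin n) K) :
    castM hm hn A = A := rfl

theorem castM_family {α : Type*} {r c : α → ℕ} (x : ∀ a, Matrix (Fin (r a)) (Fin (c a)) K)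
    {a b : α} (hab : a = b) {m n : ℕ} (hr : m = r a) (hc : n = c a) (hr' : m = r b)
    (hc' : n = c b) : castM hr hc (x a) = castM hr' hc' (x b) := by
  subst hab; rfl

theorem map_inv_matrix {m : ℕ} (A : Matrix (Fin m) (Fin m) K) (φ : K →+* K) :
    A⁻¹.map φ = (A.map φ)⁻¹ := by
  have h1 : (A.map φ).det = φ A.det := (φ.map_det A).symm
  have h2 : (A.map φ).adjugate = A.adjugate.map φ := (φ.map_adjugate A).symm
  rw [Matrix.inv_def, Matrix.inv_def, h1, h2, Ring.inverse_eq_inv', ← map_inv₀]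
  ext i j
  simp

/-- Application of a field endomorphism to the entries of an invertible matrix, up to a renaming
of the indices. -/
def glMap {m m' : ℕ} (h : m' = m) (φ : K →+* K) : GL (Fin m) K →* GL (Fin m') K :=
  Units.map
    { toFun := fun A => castM h h (A.map φ)
      map_one' := by rw [Matrix.map_one φ (map_zero φ) (map_one φ), castM_one]
      map_mul' := fun A B => by rw [Matrix.map_mul, castM_mul] }

theorem coe_glMap {m m' : ℕ} (h : m' = m) (φ : K →+* K) (g : GL (Fin m) K) :
    (glMap h φ g).1 = castM h h (g.1.map φ) := rfl

end castM

section representations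

variable {K : Type*} [Field K]

/-- The representation space `E_V = ⨁_h Hom(V_{h'}, V_{h''})`, for `V` the graded vector space
with `V_i = K^{ν_i}` on which `a : V_i → V_{a(i)}` is the identity in coordinates. -/
@[ext]
structure RepSpace (K : Type*) (ν : Q.Dim) where
  mat : ∀ h : Ω, Matrix (Fin (ν (Q.orb (Q.tgt h)))) (Fin (ν (Q.orb (Q.src h)))) K

/-- The group `G_V = ∏_i GL(V_i)`. -/
abbrev Grp (K : Type*) [Field K] (ν : Q.Dim) : Type _ := ∀ i : ι, GL (Fin (ν (Q.orb i))) K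

/-- The action `(g.x)_h = g_{h''} x_h g_{h'}⁻¹`. -/
instance (ν : Q.Dim) : MulAction (Q.Grp K ν) (Q.RepSpace K ν) where
  smul g x := ⟨fun h => (g (Q.tgt h)).1 * x.mat h * ((g (Q.src h))⁻¹).1⟩
  one_smul x := RepSpace.ext <| funext fun h => by
    show (1 : GL _ K).1 * x.mat h * ((1 : GL _ K)⁻¹).1 = x.mat h
    rw [inv_one, Units.val_one, Units.val_one, Matrix.one_mul, Matrix.mul_one]
  mul_smul g g' x := RepSpace.ext <| funext fun h => by
    show (g (Q.tgt h) * g' (Q.tgt h)).1 * x.mat h * ((g (Q.src h) * g' (Q.src h))⁻¹).1 =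
      (g (Q.tgt h)).1 * ((g' (Q.tgt h)).1 * x.mat h * ((g' (Q.src h))⁻¹).1) * ((g (Q.src h))⁻¹).1
    rw [mul_inv_rev, Units.val_mul, Units.val_mul]
    simp only [Matrix.mul_assoc]

theorem smul_apply {ν : Q.Dim} (g : Q.Grp K ν) (x : Q.RepSpace K ν) (h : Ω) :
    (g • x).mat h = (g (Q.tgt h)).1 * x.mat h * ((g (Q.src h))⁻¹).1 := rfl

variable {Q}

/-- The twisted Frobenius `F = Fr ∘ a` on `E_V`: `F(x)_h` is `x_{a(h)}` with `φ` (the Frobenius map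
of `K`) applied to all entries. -/
def frob (φ : K →+* K) {ν : Q.Dim} (x : Q.RepSpace K ν) : Q.RepSpace K ν :=
  ⟨fun h => castM (by rw [Q.orb_tgt_aE]) (by rw [Q.orb_src_aE]) ((x.mat (Q.aE h)).map φ)⟩

/-- The twisted Frobenius on `G_V`. -/
def frobG (φ : K →+* K) {ν : Q.Dim} : Q.Grp K ν →* Q.Grp K ν where
  toFun g := fun i => glMap (by rw [Q.orb_aV]) φ (g (Q.aV i))
  map_one' := funext fun i => by simp
  map_mul' g g' := funext fun i => by simp

theorem frobG_apply (φ : K →+* K) {ν : Q.Dim} (g : Q.Grp K ν) (i : ι) :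
    (frobG φ g i).1 = castM (by rw [Q.orb_aV]) (by rw [Q.orb_aV]) ((g (Q.aV i)).1.map φ) := rfl

theorem frobG_inv_apply (φ : K →+* K) {ν : Q.Dim} (g : Q.Grp K ν) (i : ι) :
    ((frobG φ g i)⁻¹).1 =
      castM (by rw [Q.orb_aV]) (by rw [Q.orb_aV]) (((g (Q.aV i))⁻¹).1.map φ) := by
  have : (frobG φ g i)⁻¹ = frobG φ g⁻¹ i := by rw [map_inv]; rfl
  rw [this, frobG_apply]; rfl

theorem frob_smul (φ : K →+* K) {ν : Q.Dim} (g : Q.Grp K ν) (x : Q.RepSpace K ν) :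
    frob φ (g • x) = frobG φ g • frob φ x := by
  refine RepSpace.ext (funext fun h => ?_)
  have e1 : ν (Q.orb (Q.tgt h)) = ν (Q.orb (Q.tgt (Q.aE h))) := by rw [Q.orb_tgt_aE]
  have e2 : ν (Q.orb (Q.src h)) = ν (Q.orb (Q.src (Q.aE h))) := by rw [Q.orb_src_aE]
  rw [smul_apply, frobG_apply, frobG_inv_apply]
  simp only [frob, smul_apply, Matrix.map_mul]
  rw [castM_mul _ e2, castM_mul _ e1]
  congr 1
  · congr 1
    exact castM_family (fun i => (g i).1.map φ) (Q.tgt_aE h) _ _ _ _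
  · exact castM_family (fun i => ((g i)⁻¹).1.map φ) (Q.src_aE h) _ _ _ _

/-- `E_V^F`. -/
abbrev RepF (φ : K →+* K) (ν : Q.Dim) : Type _ :=
  ↥(Function.fixedPoints (frob φ : Q.RepSpace K ν → Q.RepSpace K ν))

/-- `G_V^F`. -/
abbrev GrpF (φ : K →+* K) (ν : Q.Dim) : Type _ :=
  ↥(Function.fixedPoints (frobG φ : Q.Grp K ν → Q.Grp K ν))

/-- The space `H_ν` of `G_V^F`-invariant functions on `E_V^F` with values in `R`. -/
def hallSpace (φ : K →+* K) (R : Type*) [Field R] (ν : Q.Dim) :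
    Submodule R (RepF φ ν → R) where
  carrier := {f | ∀ (g : GrpF φ ν) (x y : RepF φ ν), g.1 • x.1 = y.1 → f y = f x}
  add_mem' := fun hf hf' g x y h => by simp [hf g x y h, hf' g x y h]
  zero_mem' := fun _ _ _ _ => rfl
  smul_mem' := fun c f hf g x y h => by simp [hf g x y h]

end representations

/-! ### The induction diagram -/

section blocks

variable {K : Type*} [Field K]

/-- For `V = T ⊕ W` (first the coordinates of `T`, then those of `W`), the map `T → T` induced on
`V/W`. -/
def blockT (a b c d : ℕ) (A : Matrix (Fin (a + b)) (Fin (c + d)) K) : Matrix (Fin a) (Fin c) K :=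
  A.submatrix (Fin.castAdd b) (Fin.castAdd d)

/-- The map induced on `W`. -/
def blockW (a b c d : ℕ) (A : Matrix (Fin (a + b)) (Fin (c + d)) K) : Matrix (Fin b) (Fin d) K :=
  A.submatrix (Fin.natAdd a) (Fin.natAdd c)

/-- `A` maps `W` into `W`. -/
def MapsW (a b c d : ℕ) (A : Matrix (Fin (a + b)) (Fin (c + d)) K) : Prop :=
  ∀ (r : Fin a) (s : Fin d), A (Fin.castAdd b r) (Fin.natAdd c s) = 0

theorem MapsW.mul {a b c d k l : ℕ} {A : Matrix (Fin (a + b)) (Fin (c + d)) K}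
    {B : Matrix (Fin (c + d)) (Fin (k + l)) K} (hA : MapsW a b c d A) (hB : MapsW c d k l B) :
    MapsW a b k l (A * B) := fun r s => by
  rw [Matrix.mul_apply, Fin.sum_univ_add]
  simp [hA r, hB _ s]

theorem blockT_mul {a b c d k l : ℕ} {A : Matrix (Fin (a + b)) (Fin (c + d)) K}
    {B : Matrix (Fin (c + d)) (Fin (k + l)) K} (hA : MapsW a b c d A) :
    blockT a b k l (A * B) = blockT a b c d A * blockT c d k l B := by
  ext r s
  simp [blockT, Matrix.mul_apply, Fin.sum_univ_add, hA r]

theorem blockW_mul {a b c d k l : ℕ} {A : Matrix (Fin (a + b)) (Fin (c + d)) K}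
    {B : Matrix (Fin (c + d)) (Fin (k + l)) K} (hB : MapsW c d k l B) :
    blockW a b k l (A * B) = blockW a b c d A * blockW c d k l B := by
  ext r s
  simp [blockW, Matrix.mul_apply, Fin.sum_univ_add, hB _ s]

theorem mapsW_one (a b : ℕ) : MapsW a b a b (1 : Matrix (Fin (a + b)) (Fin (a + b)) K) :=
  fun r s => Matrix.one_apply_ne (by
    intro h
    have := congrArg Fin.val h
    simp at this
    omega)

theorem blockT_one (a b : ℕ) : blockT a b a b (1 : Matrix (Fin (a + b)) (Fin (a + b)) K) = 1 :=
  Matrix.submatrix_one _ (Fin.castAdd_injective a b)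

theorem blockW_one (a b : ℕ) : blockW a b a b (1 : Matrix (Fin (a + b)) (Fin (a + b)) K) = 1 :=
  Matrix.submatrix_one _ (Fin.natAdd_injective b a)

theorem MapsW.castM {a b c d a' b' c' d' : ℕ} (ha : a' = a) (hb : b' = b) (hc : c' = c)
    (hd : d' = d) (h₁ : a' + b' = a + b) (h₂ : c' + d' = c + d)
    {A : Matrix (Fin (a + b)) (Fin (c + d)) K} (hA : MapsW a b c d A) (φ : K →+* K) :
    MapsW a' b' c' d' (castM h₁ h₂ (A.map φ)) := by
  subst ha hb hc hd
  intro r s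
  exact (congrArg φ (hA r s)).trans (map_zero φ)

theorem blockT_castM {a b c d a' b' c' d' : ℕ} (ha : a' = a) (hb : b' = b) (hc : c' = c)
    (hd : d' = d) (h₁ : a' + b' = a + b) (h₂ : c' + d' = c + d)
    (A : Matrix (Fin (a + b)) (Fin (c + d)) K) (φ : K →+* K) :
    blockT a' b' c' d' (AdmissibleQuiver.castM h₁ h₂ (A.map φ)) =
      AdmissibleQuiver.castM ha hc ((blockT a b c d A).map φ) := by
  subst ha hb hc hd; rfl

theorem blockW_castM {a b c d a' b' c' d' : ℕ} (ha : a' = a) (hb : b' = b) (hc : c' = c)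
    (hd : d' = d) (h₁ : a' + b' = a + b) (h₂ : c' + d' = c + d)
    (A : Matrix (Fin (a + b)) (Fin (c + d)) K) (φ : K →+* K) :
    blockW a' b' c' d' (AdmissibleQuiver.castM h₁ h₂ (A.map φ)) =
      AdmissibleQuiver.castM hb hd ((blockW a b c d A).map φ) := by
  subst ha hb hc hd; rfl

end blocks

section induction

variable {Q}
variable {K : Type*} [Field K] {τ ω : Q.Dim}

/-- The space `S_W` of all `x ∈ E_V` that leave `W` invariant, where `V = T ⊕ W`. -/
abbrev StabSpace (K : Type*) [Field K] (τ ω : Q.Dim) : Type _ :=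
  {x : Q.RepSpace K (τ + ω) // ∀ h, MapsW (τ (Q.orb (Q.tgt h))) (ω (Q.orb (Q.tgt h)))
    (τ (Q.orb (Q.src h))) (ω (Q.orb (Q.src h))) (x.mat h)}

/-- `x ↦ x^T`. -/
def partT (x : Q.RepSpace K (τ + ω)) : Q.RepSpace K τ :=
  ⟨fun h => blockT (τ (Q.orb (Q.tgt h))) (ω (Q.orb (Q.tgt h))) (τ (Q.orb (Q.src h)))
    (ω (Q.orb (Q.src h))) (x.mat h)⟩

/-- `x ↦ x^W`. -/
def partW (x : Q.RepSpace K (τ + ω)) : Q.RepSpace K ω :=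
  ⟨fun h => blockW (τ (Q.orb (Q.tgt h))) (ω (Q.orb (Q.tgt h))) (τ (Q.orb (Q.src h)))
    (ω (Q.orb (Q.src h))) (x.mat h)⟩

theorem partT_frob (φ : K →+* K) (x : Q.RepSpace K (τ + ω)) :
    partT (frob φ x) = frob φ (partT x) := RepSpace.ext <| funext fun h =>
  blockT_castM (by rw [Q.orb_tgt_aE]) (by rw [Q.orb_tgt_aE]) (by rw [Q.orb_src_aE])
    (by rw [Q.orb_src_aE]) _ _ (x.mat (Q.aE h)) φ

theorem partW_frob (φ : K →+* K) (x : Q.RepSpace K (τ + ω)) :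
    partW (frob φ x) = frob φ (partW x) := RepSpace.ext <| funext fun h =>
  blockW_castM (by rw [Q.orb_tgt_aE]) (by rw [Q.orb_tgt_aE]) (by rw [Q.orb_src_aE])
    (by rw [Q.orb_src_aE]) _ _ (x.mat (Q.aE h)) φ

/-- The twisted Frobenius on `S_W`. -/
def frobS (φ : K →+* K) (x : StabSpace K τ ω) : StabSpace K τ ω :=
  ⟨frob φ x.1, fun h => (x.2 (Q.aE h)).castM (by rw [Q.orb_tgt_aE]) (by rw [Q.orb_tgt_aE])
    (by rw [Q.orb_src_aE]) (by rw [Q.orb_src_aE]) _ _ φ⟩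

/-- The stabilizer of `W` in `G_V`: `g` and `g⁻¹` map `W` into `W`. -/
def parabolic (K : Type*) [Field K] (τ ω : Q.Dim) : Subgroup (Q.Grp K (τ + ω)) where
  carrier := {g | ∀ i, MapsW (τ (Q.orb i)) (ω (Q.orb i)) (τ (Q.orb i)) (ω (Q.orb i)) (g i).1 ∧
    MapsW (τ (Q.orb i)) (ω (Q.orb i)) (τ (Q.orb i)) (ω (Q.orb i)) ((g i)⁻¹).1}
  one_mem' := fun i => ⟨mapsW_one _ _, by
    rw [Pi.one_apply, inv_one]; exact mapsW_one _ _⟩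
  mul_mem' := fun {g g'} hg hg' i => ⟨(hg i).1.mul (hg' i).1, by
    rw [Pi.mul_apply, mul_inv_rev]; exact (hg' i).2.mul (hg i).2⟩
  inv_mem' := fun {g} hg i => ⟨(hg i).2, by
    rw [Pi.inv_apply, inv_inv]; exact (hg i).1⟩

/-- The unipotent radical of the stabilizer of `W`: the kernel of its map to `G_T × G_W`. -/
def unipotent (K : Type*) [Field K] (τ ω : Q.Dim) : Subgroup (Q.Grp K (τ + ω)) where
  carrier := {g | g ∈ parabolic K τ ω ∧ ∀ i,
    blockT (τ (Q.orb i)) (ω (Q.orb i)) (τ (Q.orb i)) (ω (Q.orb i)) (g i).1 = 1 ∧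
    blockW (τ (Q.orb i)) (ω (Q.orb i)) (τ (Q.orb i)) (ω (Q.orb i)) (g i).1 = 1}
  one_mem' := ⟨one_mem _, fun i => ⟨blockT_one _ _, blockW_one _ _⟩⟩
  mul_mem' := fun {g g'} hg hg' => ⟨mul_mem hg.1 hg'.1, fun i =>
    ⟨(blockT_mul (hg.1 i).1).trans (by rw [(hg.2 i).1, (hg'.2 i).1, one_mul]),
      (blockW_mul (hg'.1 i).1).trans (by rw [(hg.2 i).2, (hg'.2 i).2, one_mul])⟩⟩
  inv_mem' := fun {g} hg => ⟨inv_mem hg.1, fun i => by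
    have h1 : (g i).1 * ((g i)⁻¹).1 = 1 := Units.mul_inv (g i)
    constructor
    · have h2 := blockT_mul (K := K) (B := ((g i)⁻¹).1) (hg.1 i).1
      rw [(hg.2 i).1, one_mul] at h2
      exact h2.symm.trans ((congrArg _ h1).trans (blockT_one _ _))
    · have h2 := blockW_mul (K := K) (A := (g i).1) (hg.1 i).2
      rw [(hg.2 i).2, one_mul] at h2
      exact h2.symm.trans ((congrArg _ h1).trans (blockW_one _ _))⟩

theorem frobG_mem_parabolic (φ : K →+* K) {g : Q.Grp K (τ + ω)} (hg : g ∈ parabolic K τ ω) :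
    frobG φ g ∈ parabolic K τ ω := fun i => by
  refine ⟨(hg (Q.aV i)).1.castM (by rw [Q.orb_aV]) (by rw [Q.orb_aV]) (by rw [Q.orb_aV])
    (by rw [Q.orb_aV]) _ _ φ, ?_⟩
  rw [frobG_inv_apply]
  exact (hg (Q.aV i)).2.castM (by rw [Q.orb_aV]) (by rw [Q.orb_aV]) (by rw [Q.orb_aV])
    (by rw [Q.orb_aV]) _ _ φ

theorem frobG_mem_unipotent (φ : K →+* K) {g : Q.Grp K (τ + ω)} (hg : g ∈ unipotent K τ ω) :
    frobG φ g ∈ unipotent K τ ω := by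
  refine ⟨frobG_mem_parabolic φ hg.1, fun i => ⟨?_, ?_⟩⟩
  · refine (blockT_castM (by rw [Q.orb_aV]) (by rw [Q.orb_aV]) (by rw [Q.orb_aV])
      (by rw [Q.orb_aV]) _ _ (g (Q.aV i)).1 φ).trans ?_
    rw [(hg.2 (Q.aV i)).1, Matrix.map_one φ (map_zero φ) (map_one φ), castM_one]
  · refine (blockW_castM (by rw [Q.orb_aV]) (by rw [Q.orb_aV]) (by rw [Q.orb_aV])
      (by rw [Q.orb_aV]) _ _ (g (Q.aV i)).1 φ).trans ?_
    rw [(hg.2 (Q.aV i)).2, Matrix.map_one φ (map_zero φ) (map_one φ), castM_one]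

theorem partT_smul {u : Q.Grp K (τ + ω)} (hu : u ∈ unipotent K τ ω) {x : Q.RepSpace K (τ + ω)}
    (hx : ∀ h, MapsW (τ (Q.orb (Q.tgt h))) (ω (Q.orb (Q.tgt h)))
      (τ (Q.orb (Q.src h))) (ω (Q.orb (Q.src h))) (x.mat h)) :
    partT (u • x) = partT x := RepSpace.ext <| funext fun h => by
  refine (blockT_mul ((hu.1 (Q.tgt h)).1.mul (hx h))).trans ?_
  rw [blockT_mul (hu.1 (Q.tgt h)).1, (hu.2 (Q.tgt h)).1, Matrix.one_mul]
  refine (congrArg _ ((inv_mem hu).2 (Q.src h)).1).trans ?_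
  rw [Matrix.mul_one]; rfl

theorem partW_smul {u : Q.Grp K (τ + ω)} (hu : u ∈ unipotent K τ ω) {x : Q.RepSpace K (τ + ω)}
    (hx : ∀ h, MapsW (τ (Q.orb (Q.tgt h))) (ω (Q.orb (Q.tgt h)))
      (τ (Q.orb (Q.src h))) (ω (Q.orb (Q.src h))) (x.mat h)) :
    partW (u • x) = partW x := RepSpace.ext <| funext fun h => by
  refine (blockW_mul (hu.1 (Q.src h)).2).trans ?_
  rw [blockW_mul (hx h), (hu.2 (Q.tgt h)).2, Matrix.one_mul]
  refine (congrArg _ ((inv_mem hu).2 (Q.src h)).2).trans ?_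
  rw [Matrix.mul_one]; rfl

/-- The orbit relation on `G_V × S_W` of a subgroup `B`, for the action
`b.(g, x) = (g b⁻¹, b.x)`. -/
def orbitSetoid (B : Subgroup (Q.Grp K (τ + ω))) :
    Setoid (Q.Grp K (τ + ω) × StabSpace K τ ω) where
  r z z' := ∃ b ∈ B, z'.1 = z.1 * b⁻¹ ∧ z'.2.1 = b • z.2.1
  iseqv :=
    { refl := fun z => ⟨1, one_mem _, by simp, (one_smul _ _).symm⟩
      symm := fun {z z'} ⟨b, hb, h1, h2⟩ => ⟨b⁻¹, inv_mem hb, by simp [h1], by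
        rw [h2, inv_smul_smul]⟩
      trans := fun {z z' z''} ⟨b, hb, h1, h2⟩ ⟨c, hc, h3, h4⟩ => ⟨c * b, mul_mem hc hb, by
        rw [h3, h1, mul_inv_rev, mul_assoc], by rw [h4, h2, mul_smul]⟩ }

/-- `E'`, the set of orbits of the unipotent radical `U` on `G_V × S_W`. -/
abbrev EPrime (K : Type*) [Field K] (τ ω : Q.Dim) : Type _ :=
  Quotient (orbitSetoid (unipotent K τ ω))

/-- `E''`, the set of orbits of the stabilizer of `W` on `G_V × S_W`. -/
abbrev EDoublePrime (K : Type*) [Field K] (τ ω : Q.Dim) : Type _ :=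
  Quotient (orbitSetoid (parabolic K τ ω))

/-- The twisted Frobenius on `E'`. -/
def frobE' (φ : K →+* K) : EPrime K τ ω → EPrime K τ ω :=
  Quotient.map (fun z => (frobG φ z.1, frobS φ z.2)) fun _ _ ⟨b, hb, h1, h2⟩ =>
    ⟨frobG φ b, frobG_mem_unipotent φ hb, by simp [h1], by simp [frobS, h2, frob_smul]⟩

/-- The twisted Frobenius on `E''`. -/
def frobE'' (φ : K →+* K) : EDoublePrime K τ ω → EDoublePrime K τ ω :=
  Quotient.map (fun z => (frobG φ z.1, frobS φ z.2)) fun _ _ ⟨b, hb, h1, h2⟩ =>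
    ⟨frobG φ b, frobG_mem_parabolic φ hb, by simp [h1], by simp [frobS, h2, frob_smul]⟩

/-- The first component of `p₁ : E' → E_T × E_W`, `[g, x] ↦ x^T`. -/
def p₁T : EPrime K τ ω → Q.RepSpace K τ :=
  Quotient.lift (fun z => partT z.2.1) fun z _ ⟨_, hb, _, h2⟩ => by
    simp only [h2]; exact (partT_smul hb z.2.2).symm

/-- The second component of `p₁ : E' → E_T × E_W`, `[g, x] ↦ x^W`. -/
def p₁W : EPrime K τ ω → Q.RepSpace K ω :=
  Quotient.lift (fun z => partW z.2.1) fun z _ ⟨_, hb, _, h2⟩ => by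
    simp only [h2]; exact (partW_smul hb z.2.2).symm

/-- `p₂ : E' → E''`, `[g, x] ↦ [g, x]`. -/
def p₂ : EPrime K τ ω → EDoublePrime K τ ω :=
  Quotient.map id fun _ _ ⟨b, hb, h⟩ => ⟨b, hb.1, h⟩

/-- `p₃ : E'' → E_V`, `[g, x] ↦ g.x`. -/
def p₃ : EDoublePrime K τ ω → Q.RepSpace K (τ + ω) :=
  Quotient.lift (fun z => z.1 • z.2.1) fun z _ ⟨b, _, h1, h2⟩ => by
    simp only [h1, h2, mul_smul, inv_smul_smul]

/-- The map induced on fixed points by a map compatible with the twisted Frobenius maps. -/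
def fixMap {X Y : Type*} {F : X → X} {F' : Y → Y} (f : X → Y) (hf : Function.Semiconj f F F') :
    Function.fixedPoints F → Function.fixedPoints F' :=
  fun x => ⟨f x.1, by
    show F' (f x.1) = f x.1
    rw [← hf x.1, show F x.1 = x.1 from x.2]⟩

theorem p₁T_semiconj (φ : K →+* K) :
    Function.Semiconj (p₁T (K := K) (τ := τ) (ω := ω)) (frobE' φ) (frob φ) := by
  rintro ⟨z⟩
  exact partT_frob φ z.2.1

theorem p₁W_semiconj (φ : K →+* K) :
    Function.Semiconj (p₁W (K := K) (τ := τ) (ω := ω)) (frobE' φ) (frob φ) := by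
  rintro ⟨z⟩
  exact partW_frob φ z.2.1

theorem p₂_semiconj (φ : K →+* K) :
    Function.Semiconj (p₂ (K := K) (τ := τ) (ω := ω)) (frobE' φ) (frobE'' φ) := by
  rintro ⟨z⟩
  rfl

theorem p₃_semiconj (φ : K →+* K) :
    Function.Semiconj (p₃ (K := K) (τ := τ) (ω := ω)) (frobE'' φ) (frob φ) := by
  rintro ⟨z⟩
  exact (frob_smul φ z.1 z.2.1).symm

/-- Push-forward of functions, `f_!(u)(y) = ∑_{f(x) = y} u(x)`. -/
def pushforward {X Y M : Type*} [AddCommMonoid M] (f : X → Y) (u : X → M) (y : Y) : M :=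
  ∑ᶠ x : {x : X // f x = y}, u x.1

theorem pushforward_equiv {X Y M : Type*} [AddCommMonoid M] (f : X → Y) (u : X → M)
    (σ : X ≃ X) (ρ : Y ≃ Y) (hf : ∀ x, f (σ x) = ρ (f x)) (hu : ∀ x, u (σ x) = u x) (y : Y) :
    pushforward f u (ρ y) = pushforward f u y := by
  rw [pushforward, pushforward, ← finsum_comp_equiv (σ.subtypeEquiv (p := fun x => f x = y)
    (q := fun x => f x = ρ y) (fun x => by rw [hf, ρ.apply_eq_iff_eq]))]
  exact finsum_congr fun x => hu x.1

/-- Left translation by `g` on the orbit sets. -/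
def translate (B : Subgroup (Q.Grp K (τ + ω))) (g : Q.Grp K (τ + ω)) :
    Quotient (orbitSetoid (ω := ω) B) ≃ Quotient (orbitSetoid (ω := ω) B) where
  toFun := Quotient.map (fun z => (g * z.1, z.2)) fun _ _ ⟨b, hb, h1, h2⟩ =>
    ⟨b, hb, by simp [h1, mul_assoc], h2⟩
  invFun := Quotient.map (fun z => (g⁻¹ * z.1, z.2)) fun _ _ ⟨b, hb, h1, h2⟩ =>
    ⟨b, hb, by simp [h1, mul_assoc], h2⟩
  left_inv := by
    rintro ⟨z⟩
    exact congrArg (Quotient.mk _) (Prod.ext (inv_mul_cancel_left g z.1) rfl)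
  right_inv := by
    rintro ⟨z⟩
    exact congrArg (Quotient.mk _) (Prod.ext (mul_inv_cancel_left g z.1) rfl)

/-- The unnormalized product `(p₃)_! (p₂)_! (p₁)^* (f₁ ⊗ f₂)`, a function on `E_V^F`. -/
def rawInd (φ : K →+* K) {R : Type*} [Field R] (f₁ : RepF (K := K) φ τ → R)
    (f₂ : RepF (K := K) φ ω → R) : RepF (K := K) φ (τ + ω) → R :=
  pushforward (fixMap p₃ (p₃_semiconj φ)) (pushforward (fixMap p₂ (p₂_semiconj φ))
    fun z => f₁ (fixMap p₁T (p₁T_semiconj φ) z) * f₂ (fixMap p₁W (p₁W_semiconj φ) z))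

/-- A bijection that commutes with `F` permutes the fixed points of `F`. -/
def fixEquiv {X : Type*} {F : X → X} (σ : X ≃ X) (hσ : Function.Semiconj σ F F) :
    Function.fixedPoints F ≃ Function.fixedPoints F :=
  σ.subtypeEquiv fun x => by
    show F x = x ↔ F (σ x) = σ x
    rw [← hσ x, σ.apply_eq_iff_eq]

theorem rawInd_mem (φ : K →+* K) {R : Type*} [Field R] (f₁ : RepF (K := K) φ τ → R)
    (f₂ : RepF (K := K) φ ω → R) : rawInd φ f₁ f₂ ∈ hallSpace φ R (τ + ω) := by
  rintro ⟨g, hg⟩ x y hxy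
  have hg' : frobG φ g = g := hg
  have h1 : Function.Semiconj (translate (unipotent K τ ω) g) (frobE' φ) (frobE' φ) := by
    rintro ⟨z⟩
    refine congrArg (Quotient.mk _) (Prod.ext ?_ rfl)
    show g * frobG φ z.1 = frobG φ (g * z.1)
    rw [map_mul, hg']
  have h2 : Function.Semiconj (translate (parabolic K τ ω) g) (frobE'' φ) (frobE'' φ) := by
    rintro ⟨z⟩
    refine congrArg (Quotient.mk _) (Prod.ext ?_ rfl)
    show g * frobG φ z.1 = frobG φ (g * z.1)
    rw [map_mul, hg']
  have h3 : Function.Semiconj (MulAction.toPerm g : Equiv.Perm (Q.RepSpace K (τ + ω)))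
      (frob φ) (frob φ) := fun x => by
    show g • frob φ x = frob φ (g • x)
    rw [frob_smul, hg']
  have hy : y = fixEquiv _ h3 x := Subtype.ext hxy.symm
  rw [hy]
  refine pushforward_equiv _ _ (fixEquiv _ h2) (fixEquiv _ h3) ?_ (fun w => ?_) x
  · rintro ⟨⟨z⟩, hz⟩
    exact Subtype.ext (mul_smul g z.1 z.2.1)
  · refine pushforward_equiv _ _ (fixEquiv _ h1) (fixEquiv _ h2) ?_ ?_ w
    · rintro ⟨⟨z⟩, hz⟩
      rfl
    · rintro ⟨⟨z⟩, hz⟩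
      rfl

/-- `m_Ω(τ, ω) = ∑_i τ_i ω_i + ∑_h τ_{h'} ω_{h''}`. -/
def mExp (τ ω : Q.Dim) : ℕ :=
  ∑ᶠ i : ι, τ (Q.orb i) * ω (Q.orb i) + ∑ᶠ h : Ω, τ (Q.orb (Q.src h)) * ω (Q.orb (Q.tgt h))

/-- `Ind(f₁ ⊗ f₂) = s^{-m_Ω(τ, ω)} (# G_T^F × G_W^F)⁻¹ (p₃)_! (p₂)_! (p₁)^* (f₁ ⊗ f₂)`, where `s`
stands for `q^{1/2}`. -/
def ind (φ : K →+* K) {R : Type*} [Field R] (s : R) (f₁ : hallSpace (Q := Q) φ R τ)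
    (f₂ : hallSpace (Q := Q) φ R ω) : hallSpace (Q := Q) φ R (τ + ω) :=
  ((s ^ mExp τ ω)⁻¹ * (Nat.card (GrpF (Q := Q) φ τ × GrpF (Q := Q) φ ω) : R)⁻¹) •
    ⟨rawInd φ f₁.1 f₂.1, rawInd_mem φ f₁.1 f₂.1⟩

end induction

/-! ### The Hall algebra -/

section hall

variable {K : Type*} [Field K] (φ : K →+* K) {R : Type*} [Field R] (s : R)

/-- The underlying space `⨁_{ν ∈ ℕ[I]} H_ν` of the Hall algebra; `s` stands for `q^{1/2}` and enters
the multiplication. -/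
@[nolint unusedArguments]
def HallAlgebra (_ : R) : Type _ := ⨁ ν : Q.Dim, hallSpace (Q := Q) φ R ν

instance : AddCommGroup (Q.HallAlgebra φ s) :=
  inferInstanceAs (AddCommGroup (⨁ ν : Q.Dim, hallSpace (Q := Q) φ R ν))

instance : Module R (Q.HallAlgebra φ s) :=
  inferInstanceAs (Module R (⨁ ν : Q.Dim, hallSpace (Q := Q) φ R ν))

open Classical in
/-- The inclusion of `H_ν`. -/
def hallOf (ν : Q.Dim) : hallSpace (Q := Q) φ R ν →ₗ[R] Q.HallAlgebra φ s :=
  DirectSum.lof R Q.Dim (fun ν => hallSpace (Q := Q) φ R ν) ν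

/-- The component in `H_ν`. -/
def hallComponent (ν : Q.Dim) : Q.HallAlgebra φ s →ₗ[R] hallSpace (Q := Q) φ R ν :=
  DirectSum.component R Q.Dim (fun ν => hallSpace (Q := Q) φ R ν) ν

open Classical in
/-- The dimension vectors at which an element of the Hall algebra has a non-zero component. -/
def hallSupport (f : Q.HallAlgebra φ s) : Finset Q.Dim :=
  DFinsupp.support (β := fun ν => hallSpace (Q := Q) φ R ν) f

/-- The multiplication of the Hall algebra: `f₁ ∘ f₂ = Ind(f₁ ⊗ f₂)` for homogeneous elements. -/
instance : Mul (Q.HallAlgebra φ s) where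
  mul f g := ∑ τ ∈ Q.hallSupport φ s f, ∑ ω ∈ Q.hallSupport φ s g,
    Q.hallOf φ s (τ + ω) (ind φ s (Q.hallComponent φ s τ f) (Q.hallComponent φ s ω g))

/-- The unit: the function `1` on the point `E_V^F` for `V = 0`. -/
instance : One (Q.HallAlgebra φ s) where
  one := Q.hallOf φ s 0 ⟨fun _ => 1, fun _ _ _ _ => rfl⟩

end hall

/-! ### The contraction map and the maps of Hall algebras -/

section embedding

variable {Q}
variable [Finite ι] [Finite Ω] {e : Ω} (hC : Q.IsContractible e)
variable {K : Type*} [Field K] (φ : K →+* K) {R : Type*} [Field R] (s : R)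

theorem fold_eq (i : Q.CVertex e) : fold hC i.1 = i := Subtype.ext (fold_of_notMem hC i.2)

theorem extDim_orb (ν : (contract hC).Dim) (i : ι) :
    extDim hC ν (Q.orb i) = ν ((contract hC).orb (fold hC i)) := rfl

theorem extDim_leg (ν : (contract hC).Dim) {i : ι} (hi : i ∈ Q.orbit (Q.tgt e)) :
    extDim hC ν (Q.orb i) = extDim hC ν (Q.orb (Q.src (Q.leg e hi))) := by
  rw [extDim_orb, extDim_orb]
  congr 2
  apply Subtype.ext
  rw [fold_of_mem hC hi,
    fold_of_notMem hC (hC.disjoint (src_mem (Q.leg_sameCycle e hi)))]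

theorem extDim_tgt_leg (ν : (contract hC).Dim) {i : ι} (hi : i ∈ Q.orbit (Q.tgt e)) :
    extDim hC ν (Q.orb i) = extDim hC ν (Q.orb (Q.tgt (Q.leg e hi))) := by
  rw [Q.tgt_leg]

/-- For `i ∈ [i₋]`, the map `x_{h_k} : V_{h_k'} → V_i` with `h_k'' = i`, as a square matrix. -/
def legMat {ν : (contract hC).Dim} (x : Q.RepSpace K (extDim hC ν)) {i : ι}
    (hi : i ∈ Q.orbit (Q.tgt e)) :
    Matrix (Fin (extDim hC ν (Q.orb i))) (Fin (extDim hC ν (Q.orb i))) K :=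
  castM (extDim_tgt_leg hC ν hi) (extDim_leg hC ν hi) (x.mat (Q.leg e hi))

/-- The locus `E_V^♡` where all contracted edges `h_k` act by isomorphisms. -/
def heart (e : Ω) (ν : Q.Dim) : Set (Q.RepSpace K ν) :=
  {x | ∀ h, Q.aE.SameCycle e h → Function.Bijective (x.mat h).mulVec}

open Classical in
/-- The components of the contraction map, indexed by the edges `l` of the original graph:
`x_l x_{h_k}` if `l' = h_k''`, `x_{h_k}⁻¹ x_l` if `l'' = h_k''`, and `x_l` otherwise. -/
def contractMat {ν : (contract hC).Dim} (x : Q.RepSpace K (extDim hC ν)) (l : Ω) :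
    Matrix (Fin (extDim hC ν (Q.orb (Q.tgt l)))) (Fin (extDim hC ν (Q.orb (Q.src l)))) K :=
  if h₁ : Q.src l ∈ Q.orbit (Q.tgt e) then x.mat l * legMat hC x h₁
  else if h₂ : Q.tgt l ∈ Q.orbit (Q.tgt e) then (legMat hC x h₂)⁻¹ * x.mat l
  else x.mat l

theorem extDim_tgt (ν : (contract hC).Dim) (l : Q.CEdge e) :
    ν ((contract hC).orb ((contract hC).tgt l)) = extDim hC ν (Q.orb (Q.tgt l.1)) := rfl

theorem extDim_src (ν : (contract hC).Dim) (l : Q.CEdge e) :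
    ν ((contract hC).orb ((contract hC).src l)) = extDim hC ν (Q.orb (Q.src l.1)) := rfl

/-- The contraction map `μ_ν`, `x ↦ x̂` (it is used on `E_V^♡` only). -/
def contractMap {ν : (contract hC).Dim} (x : Q.RepSpace K (extDim hC ν)) :
    (contract hC).RepSpace K ν :=
  ⟨fun l => castM (extDim_tgt hC ν l) (extDim_src hC ν l) (contractMat hC x l.1)⟩

theorem legMat_frob {ν : (contract hC).Dim} (x : Q.RepSpace K (extDim hC ν)) {i j : ι}
    (hij : Q.aV i = j) (hi : i ∈ Q.orbit (Q.tgt e)) (hj : j ∈ Q.orbit (Q.tgt e))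
    (hd : extDim hC ν (Q.orb i) = extDim hC ν (Q.orb j)) :
    legMat hC (frob φ x) hi = castM hd hd ((legMat hC x hj).map φ) := by
  subst hij
  rw [legMat, legMat, frob, castM_castM, castM_map, castM_castM]
  exact castM_family (fun h => (x.mat h).map φ) (hC.leg_aV hi hj).symm _ _ _ _

theorem contractMat_frob {ν : (contract hC).Dim} (x : Q.RepSpace K (extDim hC ν)) (l : Ω)
    (h₁ : extDim hC ν (Q.orb (Q.tgt l)) = extDim hC ν (Q.orb (Q.tgt (Q.aE l))))
    (h₂ : extDim hC ν (Q.orb (Q.src l)) = extDim hC ν (Q.orb (Q.src (Q.aE l)))) :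
    contractMat hC (frob φ x) l = castM h₁ h₂ ((contractMat hC x (Q.aE l)).map φ) := by
  have hs : Q.src (Q.aE l) ∈ Q.orbit (Q.tgt e) ↔ Q.src l ∈ Q.orbit (Q.tgt e) := by
    rw [Q.src_aE, aV_mem_orbit]
  have ht : Q.tgt (Q.aE l) ∈ Q.orbit (Q.tgt e) ↔ Q.tgt l ∈ Q.orbit (Q.tgt e) := by
    rw [Q.tgt_aE, aV_mem_orbit]
  by_cases c₁ : Q.src l ∈ Q.orbit (Q.tgt e)
  · rw [contractMat, contractMat, dif_pos c₁, dif_pos (hs.2 c₁), Matrix.map_mul,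
      castM_mul _ h₂, legMat_frob hC φ x (Q.src_aE l).symm c₁ (hs.2 c₁) h₂]
    rfl
  · by_cases c₂ : Q.tgt l ∈ Q.orbit (Q.tgt e)
    · rw [contractMat, contractMat, dif_neg c₁, dif_neg (fun h => c₁ (hs.1 h)), dif_pos c₂,
        dif_pos (ht.2 c₂), Matrix.map_mul, castM_mul _ h₁, map_inv_matrix, castM_inv,
        legMat_frob hC φ x (Q.tgt_aE l).symm c₂ (ht.2 c₂) h₁]
      rfl
    · rw [contractMat, contractMat, dif_neg c₁, dif_neg (fun h => c₁ (hs.1 h)), dif_neg c₂,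
        dif_neg (fun h => c₂ (ht.1 h))]
      rfl

theorem contractMap_frob {ν : (contract hC).Dim} (x : Q.RepSpace K (extDim hC ν)) :
    contractMap hC (frob φ x) = frob φ (contractMap hC x) := by
  refine RepSpace.ext (funext fun l => ?_)
  simp only [contractMap, frob]
  rw [castM_map, castM_castM]
  exact (congrArg _ (contractMat_frob hC φ x l.1 (by rw [Q.orb_tgt_aE])
    (by rw [Q.orb_src_aE]))).trans (castM_castM _ _ _ _ _)

theorem extDim_val (ν : (contract hC).Dim) (i : Q.CVertex e) :
    ν ((contract hC).orb i) = extDim hC ν (Q.orb i.1) := by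
  rw [extDim_orb, fold_eq]

/-- The projection `G_V → G_V̂` that forgets the components at `[i₋]`. -/
def projG {ν : (contract hC).Dim} (g : Q.Grp K (extDim hC ν)) : (contract hC).Grp K ν :=
  fun i => glMap (extDim_val hC ν i) (RingHom.id K) (g i.1)

theorem projG_apply {ν : (contract hC).Dim} (g : Q.Grp K (extDim hC ν)) (i : Q.CVertex e) :
    (projG hC g i).1 = castM (extDim_val hC ν i) (extDim_val hC ν i) (g i.1).1 := rfl

theorem projG_inv_apply {ν : (contract hC).Dim} (g : Q.Grp K (extDim hC ν)) (i : Q.CVertex e) :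
    ((projG hC g i)⁻¹).1 =
      castM (extDim_val hC ν i) (extDim_val hC ν i) ((g i.1)⁻¹).1 := by
  rw [projG, ← map_inv]; rfl

theorem projG_frob {ν : (contract hC).Dim} (g : Q.Grp K (extDim hC ν)) :
    projG hC (frobG φ g) = frobG φ (projG hC g) := by
  funext i
  refine Units.ext ?_
  rw [projG_apply, frobG_apply, frobG_apply, projG_apply, castM_map, castM_castM, castM_castM]
  rfl

theorem extDim_fold (ν : (contract hC).Dim) (i : ι) :
    extDim hC ν (Q.orb i) = extDim hC ν (Q.orb (fold hC i).1) := by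
  rw [extDim_orb, extDim_orb, fold_eq]

theorem legMat_smul {ν : (contract hC).Dim} (g : Q.Grp K (extDim hC ν))
    (x : Q.RepSpace K (extDim hC ν)) {i : ι} (hi : i ∈ Q.orbit (Q.tgt e)) :
    legMat hC (g • x) hi = (g i).1 * legMat hC x hi *
      castM (extDim_fold hC ν i) (extDim_fold hC ν i) ((g (fold hC i).1)⁻¹).1 := by
  rw [legMat, smul_apply, castM_mul _ (extDim_leg hC ν hi), castM_mul _ (extDim_tgt_leg hC ν hi)]
  congr 1
  · congr 1
    exact castM_family (fun i => (g i).1) (Q.tgt_leg e hi) _ _ rfl rfl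
  · exact castM_family (fun i => ((g i)⁻¹).1) (fold_of_mem hC hi).symm _ _ _ _

theorem contractMat_smul {ν : (contract hC).Dim} (g : Q.Grp K (extDim hC ν))
    (x : Q.RepSpace K (extDim hC ν)) {l : Ω}
    (hl : ¬ (Q.src l ∈ Q.orbit (Q.tgt e) ∧ Q.tgt l ∈ Q.orbit (Q.tgt e))) :
    contractMat hC (g • x) l =
      castM (extDim_fold hC ν _) (extDim_fold hC ν _) (g (fold hC (Q.tgt l)).1).1 *
        contractMat hC x l *
        castM (extDim_fold hC ν _) (extDim_fold hC ν _) ((g (fold hC (Q.src l)).1)⁻¹).1 := by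
  have key : ∀ i, i ∉ Q.orbit (Q.tgt e) →
      castM (extDim_fold hC ν i) (extDim_fold hC ν i) (g (fold hC i).1).1 = (g i).1 :=
    fun i hi => castM_family (fun i => (g i).1) (fold_of_notMem hC hi) _ _ rfl rfl
  have key' : ∀ i, i ∉ Q.orbit (Q.tgt e) →
      castM (extDim_fold hC ν i) (extDim_fold hC ν i) ((g (fold hC i).1)⁻¹).1 = ((g i)⁻¹).1 :=
    fun i hi => castM_family (fun i => ((g i)⁻¹).1) (fold_of_notMem hC hi) _ _ rfl rfl
  by_cases c₁ : Q.src l ∈ Q.orbit (Q.tgt e)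
  · have c₂ : Q.tgt l ∉ Q.orbit (Q.tgt e) := fun h => hl ⟨c₁, h⟩
    rw [contractMat, contractMat, dif_pos c₁, dif_pos c₁, key _ c₂, legMat_smul, smul_apply]
    have h0 : ((g (Q.src l))⁻¹).1 * (g (Q.src l)).1 = 1 := Units.inv_mul _
    simp only [Matrix.mul_assoc]
    rw [← Matrix.mul_assoc _ (g (Q.src l)).1, h0, Matrix.one_mul]
  · by_cases c₂ : Q.tgt l ∈ Q.orbit (Q.tgt e)
    · rw [contractMat, contractMat, dif_neg c₁, dif_neg c₁, dif_pos c₂, dif_pos c₂, key' _ c₁,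
        legMat_smul, smul_apply, Matrix.mul_inv_rev, Matrix.mul_inv_rev, ← castM_inv,
        ← Matrix.coe_units_inv, ← Matrix.coe_units_inv, inv_inv]
      have h0 : ((g (Q.tgt l))⁻¹).1 * (g (Q.tgt l)).1 = 1 := Units.inv_mul _
      simp only [Matrix.mul_assoc]
      rw [← Matrix.mul_assoc _ (g (Q.tgt l)).1, h0, Matrix.one_mul]
    · rw [contractMat, contractMat, dif_neg c₁, dif_neg c₁, dif_neg c₂, dif_neg c₂, key _ c₂,
        key' _ c₁, smul_apply]

theorem contractMap_smul {ν : (contract hC).Dim} (g : Q.Grp K (extDim hC ν))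
    (x : Q.RepSpace K (extDim hC ν)) :
    contractMap hC (g • x) = projG hC g • contractMap hC x := by
  refine RepSpace.ext (funext fun l => ?_)
  have hl : ¬ (Q.src l.1 ∈ Q.orbit (Q.tgt e) ∧ Q.tgt l.1 ∈ Q.orbit (Q.tgt e)) := fun ⟨h₁, h₂⟩ => by
    by_cases h : Q.src l.1 = Q.tgt l.1
    · exact src_ne_of_loops hC.loops_tgt h₁ l.1 rfl h.symm
    · exact Q.admissible _ h (h₁.symm.trans h₂)
  rw [smul_apply, projG_apply, projG_inv_apply]
  simp only [contractMap]
  rw [contractMat_smul hC g x hl, castM_mul _ (extDim_src hC ν l),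
    castM_mul _ (extDim_tgt hC ν l), castM_castM, castM_castM]
  rfl

theorem smul_mem_heart {ν : Q.Dim} (g : Q.Grp K ν) {x : Q.RepSpace K ν}
    (hx : x ∈ heart e ν) : g • x ∈ heart e ν := fun h hh => by
  have hb : ∀ i, Function.Bijective (g i).1.mulVec := fun i =>
    ⟨Matrix.mulVec_injective_iff_isUnit.2 (g i).isUnit,
      Matrix.mulVec_surjective_iff_isUnit.2 (g i).isUnit⟩
  have h1 : ((g • x).mat h).mulVec =
      (g (Q.tgt h)).1.mulVec ∘ (x.mat h).mulVec ∘ ((g⁻¹) (Q.src h)).1.mulVec := by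
    funext v
    simp [smul_apply, Matrix.mulVec_mulVec, Matrix.mul_assoc]
  rw [h1]
  exact (hb _).comp ((hx h hh).comp ⟨Matrix.mulVec_injective_iff_isUnit.2 (g⁻¹ _).isUnit,
    Matrix.mulVec_surjective_iff_isUnit.2 (g⁻¹ _).isUnit⟩)

/-- `E_V^{♡, F}`. -/
abbrev HeartF (ν : (contract hC).Dim) : Type _ :=
  {x : RepF (Q := Q) φ (extDim hC ν) // x.1 ∈ heart e (extDim hC ν)}

/-- The space `H_ν^♡` of `G_V^F`-invariant functions on `E_V^{♡, F}`. -/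
def heartSpace (R : Type*) [Field R] (ν : (contract hC).Dim) :
    Submodule R (HeartF hC φ ν → R) where
  carrier := {f | ∀ (g : GrpF (Q := Q) φ (extDim hC ν)) (x y : HeartF hC φ ν),
    g.1 • x.1.1 = y.1.1 → f y = f x}
  add_mem' := fun hf hf' g x y h => by simp [hf g x y h, hf' g x y h]
  zero_mem' := fun _ _ _ _ => rfl
  smul_mem' := fun c f hf g x y h => by simp [hf g x y h]

/-- The contraction map `μ_ν : E_V^{♡, F} → E_V̂^F`. -/
def mu (ν : (contract hC).Dim) (x : HeartF hC φ ν) : RepF (Q := contract hC) φ ν :=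
  fixMap (contractMap hC) (contractMap_frob hC φ) x.1

/-- The pullback `μ_ν^*`. -/
def muPull (R : Type*) [Field R] (ν : (contract hC).Dim) :
    hallSpace (Q := contract hC) φ R ν →ₗ[R] heartSpace hC φ R ν where
  toFun f := ⟨fun x => f.1 (mu hC φ ν x), fun g x y h =>
    f.2 ⟨projG hC g.1, by
      show frobG φ (projG hC g.1) = projG hC g.1
      rw [← projG_frob, show frobG φ g.1 = g.1 from g.2]⟩ _ _ (by
        show projG hC g.1 • contractMap hC x.1.1 = contractMap hC y.1.1
        rw [← contractMap_smul, h])⟩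
  map_add' _ _ := rfl
  map_smul' _ _ := rfl

/-- The twisted pullback `μ_ν^⋆ = (q^{-1/2})^{ν_{i₋}² φ₁(i₋)} μ_ν^*`. -/
def muStar (ν : (contract hC).Dim) :
    hallSpace (Q := contract hC) φ R ν →ₗ[R] heartSpace hC φ R ν :=
  (s⁻¹ ^ (extDim hC ν (Q.orb (Q.tgt e)) ^ 2 * Q.φ₁ (Q.tgt e))) • muPull hC φ R ν

open Classical in
/-- Extension by zero `(j_ν)_! : H_ν^♡ → H_ν`. -/
def jShriek (R : Type*) [Field R] (ν : (contract hC).Dim) :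
    heartSpace hC φ R ν →ₗ[R] hallSpace (Q := Q) φ R (extDim hC ν) where
  toFun f := ⟨fun x => if hx : x.1 ∈ heart e (extDim hC ν) then f.1 ⟨x, hx⟩ else 0,
    fun g x y h => by
      by_cases hx : x.1 ∈ heart e (extDim hC ν)
      · have hy : y.1 ∈ heart e (extDim hC ν) := h ▸ smul_mem_heart g.1 hx
        simp only [dif_pos hx, dif_pos hy]
        exact f.2 g ⟨x, hx⟩ ⟨y, hy⟩ h
      · have hy : y.1 ∉ heart e (extDim hC ν) := fun hy => hx (by
          have := smul_mem_heart g.1⁻¹ hy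
          rwa [← h, inv_smul_smul] at this)
        simp only [dif_neg hx, dif_neg hy]⟩
  map_add' f f' := Subtype.ext <| funext fun x => by
    by_cases hx : x.1 ∈ heart e (extDim hC ν) <;> simp [hx]
  map_smul' c f := Subtype.ext <| funext fun x => by
    by_cases hx : x.1 ∈ heart e (extDim hC ν) <;> simp [hx]

/-- `H^♡ = ⨁_{ν ∈ ℕ[Î]} H_ν^♡`. -/
abbrev HeartHall (R : Type*) [Field R] : Type _ := ⨁ ν : (contract hC).Dim, heartSpace hC φ R ν

/-- `μ^⋆ : Ĥ → H^♡`. -/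
def muStarHall : (contract hC).HallAlgebra φ s →ₗ[R] HeartHall hC φ R :=
  DirectSum.lmap fun ν => muStar hC φ s ν

open Classical in
/-- `j_! : H^♡ → H`. -/
def jShriekHall : HeartHall hC φ R →ₗ[R] Q.HallAlgebra φ s :=
  DirectSum.toModule R _ _ fun ν => Q.hallOf φ s (extDim hC ν) ∘ₗ jShriek hC φ R ν

/-- `ψ = j_! ∘ μ^⋆`. -/
def psi : (contract hC).HallAlgebra φ s →ₗ[R] Q.HallAlgebra φ s :=
  jShriekHall hC φ s ∘ₗ muStarHall hC φ s

end embedding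

end AdmissibleQuiver

/-- The Frobenius map `x ↦ x^q`, `q = p^n`, of the algebraic closure of `𝔽_p`. -/
abbrev Fr (p : ℕ) [Fact p.Prime] (n : ℕ) :
    AlgebraicClosure (ZMod p) →+* AlgebraicClosure (ZMod p) :=
  iterateFrobenius (AlgebraicClosure (ZMod p)) p n

/-- The field `ℚ(s)`, a subfield of `ℂ`. -/
abbrev Coeff (s : ℂ) : Type := IntermediateField.adjoin ℚ {s}

/-- The number `s` as an element of `ℚ(s)`. -/
abbrev root (s : ℂ) : Coeff s := IntermediateField.AdjoinSimple.gen ℚ s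

end HallContraction
end

open scoped DirectSum

noncomputable section

set_option linter.unusedSectionVars false

namespace HallContraction

namespace AdmissibleQuiver

/-! ### Block triangular matrices -/

section levi

variable {K : Type*} [Field K]

/-! Where the edges `h_k` act by isomorphisms, they serve only to identify the space at `h_k''` with
the one at `h_k'`. The contraction map has the section `inflate`, in which every `h_k` acts by the
identity; it is equivariant along `diag`, which is a section of `projG`, and both commute with `F`.
By `exists_smul_inflate`, every `F`-fixed point of `E_V^♡` is obtained from an inflated `F`-fixed
point by an `F`-fixed group element. Both sides of `ψ(f ∘ g) = ψ(f) ∘ ψ(g)` are invariant functions,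
so they need only be compared at inflated points and off `E_V^♡`.

Off `E_V^♡` both sides vanish: an extension of two representations on which the `h_k` are invertible
has the same property (`rawInd_eq_zero`).

At an inflated point, a stable subspace has the same component at `h_k'` and at `h_k''`, hence it
comes from a stable subspace of the contracted representation. So the fibres of `p₃` agree, through
`inflateE''`. The fibres of `p₂` are torsors under `G_T × G_W` on one side and under its contracted
analogue on the other. The excess is the kernel of the projection in both factors, and its elements
`l` parametrize the maps `inflateE' l`, which together cover the fibre without repetition
(`exists_inflateE'`, `inflateE'_injective`). Counting `F`-fixed points gives `rawInd_inflateF`: the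
unnormalized products differ by the orders of the two kernels and by the scalars in `ψ`.

The orders of the kernels cancel against the group orders in the normalization, by `grpFEquiv`. With
`a`, `b` the dimensions of `T`, `W` at `i₋` and `φ` the size of `[i₋]`, the exponent `m_Ω` grows by
`2φab = φ((a + b)² - a² - b²)` (`mExp_extDim`), which is exactly what the twist in `μ^⋆` absorbs;
this is `psiHom_ind`.

Injectivity of each component follows by evaluating at inflated points. Since `extDim` is injective,
distinct components of `Ĥ` go to distinct components of `H`, so the homogeneous statements assemble
to statements on the direct sums. -/

theorem ext_blocks {a b c d : ℕ} {A B : Matrix (Fin (a + b)) (Fin (c + d)) K}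
    (hA : MapsW a b c d A) (hB : MapsW a b c d B)
    (hT : blockT a b c d A = blockT a b c d B) (hW : blockW a b c d A = blockW a b c d B)
    (hc : ∀ r s, A (Fin.natAdd a r) (Fin.castAdd d s) = B (Fin.natAdd a r) (Fin.castAdd d s)) :
    A = B := by
  ext i j
  refine Fin.addCases (fun i => ?_) (fun i => ?_) i <;>
    refine Fin.addCases (fun j => ?_) (fun j => ?_) j
  · exact congrFun (congrFun hT i) j
  · rw [hA, hB]
  · exact hc i j
  · exact congrFun (congrFun hW i) j

/-- The block diagonal matrix with blocks `A` and `B`. -/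
def leviMat (a b : ℕ) (A : Matrix (Fin a) (Fin a) K) (B : Matrix (Fin b) (Fin b) K) :
    Matrix (Fin (a + b)) (Fin (a + b)) K :=
  (Matrix.fromBlocks A 0 0 B).submatrix finSumFinEquiv.symm finSumFinEquiv.symm

theorem blockT_leviMat {a b : ℕ} (A : Matrix (Fin a) (Fin a) K) (B : Matrix (Fin b) (Fin b) K) :
    blockT a b a b (leviMat a b A B) = A := by
  ext i j; simp [blockT, leviMat]

theorem blockW_leviMat {a b : ℕ} (A : Matrix (Fin a) (Fin a) K) (B : Matrix (Fin b) (Fin b) K) :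
    blockW a b a b (leviMat a b A B) = B := by
  ext i j; simp [blockW, leviMat]

theorem mapsW_leviMat {a b : ℕ} (A : Matrix (Fin a) (Fin a) K) (B : Matrix (Fin b) (Fin b) K) :
    MapsW a b a b (leviMat a b A B) := fun i j => by
  simp [leviMat]

theorem leviMat_mul {a b : ℕ} (A A' : Matrix (Fin a) (Fin a) K) (B B' : Matrix (Fin b) (Fin b) K) :
    leviMat a b (A * A') (B * B') = leviMat a b A B * leviMat a b A' B' := by
  rw [leviMat, leviMat, leviMat, Matrix.submatrix_mul_equiv, Matrix.fromBlocks_multiply]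
  simp

theorem leviMat_one (a b : ℕ) : leviMat a b (1 : Matrix (Fin a) (Fin a) K) 1 = 1 := by
  rw [leviMat, Matrix.fromBlocks_one, Matrix.submatrix_one_equiv]

theorem castM_leviMat {a b a' b' : ℕ} (ha : a' = a) (hb : b' = b) (h h' : a' + b' = a + b)
    (A : Matrix (Fin a) (Fin a) K) (B : Matrix (Fin b) (Fin b) K) (φ : K →+* K) :
    castM h h' ((leviMat a b A B).map φ) =
      leviMat a' b' (castM ha ha (A.map φ)) (castM hb hb (B.map φ)) := by
  subst ha hb
  ext i j
  refine Fin.addCases (fun i => ?_) (fun i => ?_) i <;>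
    refine Fin.addCases (fun j => ?_) (fun j => ?_) j <;> simp [leviMat, castM]

/-- The embedding `GL_a × GL_b → GL_{a+b}` as block diagonal matrices. -/
def leviGL (a b : ℕ) : GL (Fin a) K × GL (Fin b) K →* GL (Fin (a + b)) K where
  toFun g := ⟨leviMat a b g.1.1 g.2.1, leviMat a b (g.1⁻¹).1 (g.2⁻¹).1,
    by rw [← leviMat_mul, Units.mul_inv, Units.mul_inv, leviMat_one],
    by rw [← leviMat_mul, Units.inv_mul, Units.inv_mul, leviMat_one]⟩
  map_one' := Units.ext (leviMat_one a b)
  map_mul' _ _ := Units.ext (leviMat_mul _ _ _ _)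

theorem coe_leviGL {a b : ℕ} (g : GL (Fin a) K × GL (Fin b) K) :
    (leviGL a b g).1 = leviMat a b g.1.1 g.2.1 := rfl

theorem fromBlocks_submatrix {a b c d : ℕ} {A : Matrix (Fin (a + b)) (Fin (c + d)) K}
    (hA : MapsW a b c d A) : A.submatrix finSumFinEquiv finSumFinEquiv =
      Matrix.fromBlocks (blockT a b c d A) 0
        (A.submatrix (Fin.natAdd a) (Fin.castAdd d)) (blockW a b c d A) := by
  ext (i | i) (j | j)
  · simp [blockT]
  · simpa using hA i j
  · simp
  · simp [blockW]

theorem MapsW.det {a b : ℕ} {A : Matrix (Fin (a + b)) (Fin (a + b)) K} (hA : MapsW a b a b A) :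
    A.det = (blockT a b a b A).det * (blockW a b a b A).det := by
  rw [← Matrix.det_submatrix_equiv_self finSumFinEquiv, fromBlocks_submatrix hA,
    Matrix.det_fromBlocks_zero₁₂]

/-- An extension of isomorphisms is an isomorphism, since the determinant is the product of those of
the diagonal blocks. The equalities of sizes make all blocks square. -/
theorem MapsW.bijective {a b c d : ℕ} (hac : a = c) (hbd : b = d)
    {A : Matrix (Fin (a + b)) (Fin (c + d)) K} (hA : MapsW a b c d A)
    (hT : Function.Bijective (blockT a b c d A).mulVec)
    (hW : Function.Bijective (blockW a b c d A).mulVec) : Function.Bijective A.mulVec := by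
  subst hac hbd
  have h : IsUnit A := by
    rw [Matrix.isUnit_iff_isUnit_det, hA.det]
    exact ((Matrix.isUnit_iff_isUnit_det _).1 (Matrix.mulVec_injective_iff_isUnit.1 hT.1)).mul
      ((Matrix.isUnit_iff_isUnit_det _).1 (Matrix.mulVec_injective_iff_isUnit.1 hW.1))
  exact ⟨Matrix.mulVec_injective_iff_isUnit.2 h, Matrix.mulVec_surjective_iff_isUnit.2 h⟩

theorem MapsW.sub {a b c d : ℕ} {A B : Matrix (Fin (a + b)) (Fin (c + d)) K}
    (hA : MapsW a b c d A) (hB : MapsW a b c d B) : MapsW a b c d (A - B) := fun i j => by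
  rw [Matrix.sub_apply, hA, hB, sub_zero]

/-- `u - 1` has only a block from `T` to `W`, so its square is zero and `u⁻¹ = 1 - (u - 1)`. This is
needed because membership in `parabolic` requires both `g` and `g⁻¹` to preserve `W`. -/
theorem mapsW_inv_of_blocks_one {a b : ℕ} {u : GL (Fin (a + b)) K} (hu : MapsW a b a b u.1)
    (hT : blockT a b a b u.1 = 1) (hW : blockW a b a b u.1 = 1) : MapsW a b a b (u⁻¹).1 := by
  have h0 : (u.1 - 1) * (u.1 - 1) = 0 := by
    have h1 := hu.sub (mapsW_one (K := K) a b)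
    have hT' : blockT a b a b (u.1 - 1) = 0 := by
      rw [← sub_eq_zero.2 (hT.trans (blockT_one a b).symm)]; rfl
    have hW' : blockW a b a b (u.1 - 1) = 0 := by
      rw [← sub_eq_zero.2 (hW.trans (blockW_one a b).symm)]; rfl
    refine ext_blocks (h1.mul h1) (fun _ _ => rfl) ?_ ?_ fun r s => ?_
    · rw [blockT_mul h1, hT', Matrix.zero_mul]; rfl
    · rw [blockW_mul h1, hW', Matrix.zero_mul]; rfl
    · rw [Matrix.mul_apply, Fin.sum_univ_add]
      have e1 : ∀ i, (u.1 - 1) (Fin.castAdd b i) (Fin.castAdd b s) = 0 :=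
        fun i => congrFun (congrFun hT' i) s
      have e2 : ∀ i, (u.1 - 1) (Fin.natAdd a r) (Fin.natAdd a i) = 0 :=
        fun i => congrFun (congrFun hW' r) i
      simp only [e1, e2]
      simp
  have h2 : (u⁻¹).1 = 1 - (u.1 - 1) := by
    refine Units.inv_eq_of_mul_eq_one_right ?_
    have : u.1 * (1 - (u.1 - 1)) = 1 - (u.1 - 1) * (u.1 - 1) := by noncomm_ring
    rw [this, h0, sub_zero]
  rw [h2]
  exact (mapsW_one a b).sub (hu.sub (mapsW_one a b))

/-- An invertible block triangular matrix is, up to a block diagonal factor, unipotent. -/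
theorem exists_mul_leviGL {a b : ℕ} {A : GL (Fin (a + b)) K} (hA : MapsW a b a b A.1) :
    ∃ (k : GL (Fin a) K) (m : GL (Fin b) K),
      MapsW a b a b (A * leviGL a b (k, m)).1 ∧ MapsW a b a b ((A * leviGL a b (k, m))⁻¹).1 ∧
      blockT a b a b (A * leviGL a b (k, m)).1 = 1 ∧
      blockW a b a b (A * leviGL a b (k, m)).1 = 1 ∧
      blockT a b a b A.1 = (k⁻¹).1 ∧ blockW a b a b A.1 = (m⁻¹).1 := by
  have hd := (Matrix.isUnit_iff_isUnit_det _).1 A.isUnit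
  rw [hA.det, IsUnit.mul_iff, ← Matrix.isUnit_iff_isUnit_det, ← Matrix.isUnit_iff_isUnit_det] at hd
  -- Both diagonal blocks are invertible because the product of their determinants is; the witnesses
  -- are the inverses of the blocks.
  obtain ⟨⟨k, hk⟩, ⟨m, hm⟩⟩ := hd
  have hv : MapsW a b a b (A * leviGL a b (k⁻¹, m⁻¹)).1 := hA.mul (mapsW_leviMat _ _)
  have hvT : blockT a b a b (A * leviGL a b (k⁻¹, m⁻¹)).1 = 1 := by
    rw [Units.val_mul, coe_leviGL, blockT_mul hA, blockT_leviMat, ← hk, Units.mul_inv]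
  have hvW : blockW a b a b (A * leviGL a b (k⁻¹, m⁻¹)).1 = 1 := by
    rw [Units.val_mul, coe_leviGL, blockW_mul (mapsW_leviMat _ _), blockW_leviMat, ← hm,
      Units.mul_inv]
  exact ⟨k⁻¹, m⁻¹, hv, mapsW_inv_of_blocks_one hv hvT hvW, hvT, hvW, by rw [inv_inv, hk],
    by rw [inv_inv, hm]⟩

end levi

/-! ### The Levi subgroup of the stabilizer of `W` -/

section leviGroup

variable {ι Ω : Type*} {Q : AdmissibleQuiver ι Ω} {K : Type*} [Field K] {τ ω : Q.Dim}

/-- The embedding `G_T × G_W → G_V` for `V = T ⊕ W`. -/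
def levi (τ ω : Q.Dim) : Q.Grp K τ × Q.Grp K ω →* Q.Grp K (τ + ω) where
  toFun l := fun i => leviGL (τ (Q.orb i)) (ω (Q.orb i)) (l.1 i, l.2 i)
  map_one' := funext fun i => map_one (leviGL (τ (Q.orb i)) (ω (Q.orb i)))
  map_mul' l l' := funext fun i => map_mul (leviGL (τ (Q.orb i)) (ω (Q.orb i)))
    (l.1 i, l.2 i) (l'.1 i, l'.2 i)

theorem levi_mem (l : Q.Grp K τ × Q.Grp K ω) : levi τ ω l ∈ parabolic K τ ω := fun i => by
  refine ⟨mapsW_leviMat _ _, ?_⟩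
  rw [← Pi.inv_apply, ← map_inv]
  exact mapsW_leviMat _ _

theorem blockT_levi (l : Q.Grp K τ × Q.Grp K ω) (i : ι) :
    blockT (τ (Q.orb i)) (ω (Q.orb i)) (τ (Q.orb i)) (ω (Q.orb i)) (levi τ ω l i).1 = (l.1 i).1 :=
  blockT_leviMat _ _

theorem blockW_levi (l : Q.Grp K τ × Q.Grp K ω) (i : ι) :
    blockW (τ (Q.orb i)) (ω (Q.orb i)) (τ (Q.orb i)) (ω (Q.orb i)) (levi τ ω l i).1 = (l.2 i).1 :=
  blockW_leviMat _ _

theorem frobG_levi (φ : K →+* K) (l : Q.Grp K τ × Q.Grp K ω) :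
    frobG φ (levi τ ω l) = levi τ ω (frobG φ l.1, frobG φ l.2) := funext fun i => Units.ext <|
  castM_leviMat (by rw [Q.orb_aV]) (by rw [Q.orb_aV]) _ _ _ _ φ

theorem smul_mapsW {b : Q.Grp K (τ + ω)} (hb : b ∈ parabolic K τ ω) {x : Q.RepSpace K (τ + ω)}
    (hx : ∀ h, MapsW (τ (Q.orb (Q.tgt h))) (ω (Q.orb (Q.tgt h)))
      (τ (Q.orb (Q.src h))) (ω (Q.orb (Q.src h))) (x.mat h)) (h : Ω) :
    MapsW (τ (Q.orb (Q.tgt h))) (ω (Q.orb (Q.tgt h)))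
      (τ (Q.orb (Q.src h))) (ω (Q.orb (Q.src h))) ((b • x).mat h) :=
  ((hb _).1.mul (hx h)).mul (hb _).2

theorem partT_levi_smul (l : Q.Grp K τ × Q.Grp K ω) {x : Q.RepSpace K (τ + ω)}
    (hx : ∀ h, MapsW (τ (Q.orb (Q.tgt h))) (ω (Q.orb (Q.tgt h)))
      (τ (Q.orb (Q.src h))) (ω (Q.orb (Q.src h))) (x.mat h)) :
    partT (levi τ ω l • x) = l.1 • partT x := RepSpace.ext <| funext fun h => by
  refine (blockT_mul ((levi_mem l (Q.tgt h)).1.mul (hx h))).trans ?_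
  rw [blockT_mul (levi_mem l (Q.tgt h)).1, blockT_levi]
  refine congrArg _ ?_
  rw [← Pi.inv_apply, ← map_inv, blockT_levi]
  rfl

theorem partW_levi_smul (l : Q.Grp K τ × Q.Grp K ω) {x : Q.RepSpace K (τ + ω)}
    (hx : ∀ h, MapsW (τ (Q.orb (Q.tgt h))) (ω (Q.orb (Q.tgt h)))
      (τ (Q.orb (Q.src h))) (ω (Q.orb (Q.src h))) (x.mat h)) :
    partW (levi τ ω l • x) = l.2 • partW x := RepSpace.ext <| funext fun h => by
  refine (blockW_mul (levi_mem l (Q.src h)).2).trans ?_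
  rw [blockW_mul (hx h), blockW_levi]
  refine congrArg _ ?_
  rw [← Pi.inv_apply, ← map_inv, blockW_levi]
  rfl

/-- The Levi subgroup normalizes the unipotent radical. This makes the twist by `l` in `inflateE'`
well defined on orbits. -/
theorem levi_inv_mul_mul_mem (l : Q.Grp K τ × Q.Grp K ω) {u : Q.Grp K (τ + ω)}
    (hu : u ∈ unipotent K τ ω) : (levi τ ω l)⁻¹ * u * levi τ ω l ∈ unipotent K τ ω := by
  refine ⟨mul_mem (mul_mem (inv_mem (levi_mem l)) hu.1) (levi_mem l), fun i => ?_⟩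
  have h0 := mul_mem (inv_mem (levi_mem l)) hu.1
  constructor
  · refine (blockT_mul (h0 i).1).trans ?_
    refine (congrArg (· * _) (blockT_mul ((inv_mem (levi_mem l)) i).1)).trans ?_
    rw [(hu.2 i).1, Matrix.mul_one, blockT_levi, ← map_inv, blockT_levi]
    exact Units.inv_mul _
  · refine (blockW_mul (levi_mem l i).1).trans ?_
    refine (congrArg (· * _) (blockW_mul (hu.1 i).1)).trans ?_
    rw [(hu.2 i).2, Matrix.mul_one, blockW_levi, ← map_inv, blockW_levi]
    exact Units.inv_mul _

end leviGroup

/-! ### Sections of the contraction map and of the projection of groups -/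

section inflation

variable {ι Ω : Type*} {Q : AdmissibleQuiver ι Ω} [Finite ι] [Finite Ω] {e : Ω}
variable (hC : Q.IsContractible e) {K : Type*} [Field K] (φ : K →+* K)

theorem fold_aV_eq (i : ι) : fold hC (Q.aV i) = (contract hC).aV (fold hC i) :=
  Subtype.ext (fold_aV hC i)

/-- A contracted edge is determined by its target, so the edge that `leg` chooses at `h''` is `h`
itself. Thus the spaces at the two ends of `h` have equal dimension and the identity between them
makes sense. -/
theorem fold_tgt_eq_fold_src {h : Ω} (hh : Q.aE.SameCycle e h) :
    fold hC (Q.tgt h) = fold hC (Q.src h) := Subtype.ext <| by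
  rw [fold_of_mem hC (tgt_mem hh), fold_of_notMem hC (hC.disjoint (src_mem hh)),
    hC.eq_of_tgt (Q.leg_sameCycle e (tgt_mem hh)) hh (Q.tgt_leg e (tgt_mem hh))]

theorem extDim_tgt_eq_src (ν : (contract hC).Dim) {h : Ω} (hh : Q.aE.SameCycle e h) :
    extDim hC ν (Q.orb (Q.tgt h)) = extDim hC ν (Q.orb (Q.src h)) := by
  rw [extDim_orb, extDim_orb, fold_tgt_eq_fold_src hC hh]

/-- The embedding `G_V̂ → G_V` that repeats the component at `h_k'` at the vertex `h_k''`. -/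
def diag (ν : (contract hC).Dim) : (contract hC).Grp K ν →* Q.Grp K (extDim hC ν) where
  toFun g := fun i => g (fold hC i)
  map_one' := rfl
  map_mul' _ _ := rfl

theorem projG_diag {ν : (contract hC).Dim} (g : (contract hC).Grp K ν) :
    projG hC (diag hC ν g) = g := funext fun i => Units.ext <|
  castM_family (fun i => (g i).1) (fold_eq hC i) _ _ rfl rfl

theorem diag_projG_apply {ν : (contract hC).Dim} (g : Q.Grp K (extDim hC ν)) {i : ι}
    (hi : i ∉ Q.orbit (Q.tgt e)) : diag hC ν (projG hC g) i = g i := Units.ext <|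
  castM_family (fun i => (g i).1) (fold_of_notMem hC hi) _ _ rfl rfl

theorem diag_frobG {ν : (contract hC).Dim} (g : (contract hC).Grp K ν) :
    diag hC ν (frobG φ g) = frobG φ (diag hC ν g) := funext fun i => Units.ext <|
  castM_family (fun i => (g i).1.map φ) (fold_aV_eq hC i).symm _ _ _ _

theorem projG_mul {ν : (contract hC).Dim} (g g' : Q.Grp K (extDim hC ν)) :
    projG hC (g * g') = projG hC g * projG hC g' :=
  funext fun i => map_mul (glMap (extDim_val hC ν i) (RingHom.id K)) (g i.1) (g' i.1)

theorem projG_one {ν : (contract hC).Dim} : projG hC (1 : Q.Grp K (extDim hC ν)) = 1 :=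
  funext fun i => map_one (glMap (extDim_val hC ν i) (RingHom.id K))

theorem projG_inv {ν : (contract hC).Dim} (g : Q.Grp K (extDim hC ν)) :
    projG hC g⁻¹ = (projG hC g)⁻¹ :=
  funext fun i => map_inv (glMap (extDim_val hC ν i) (RingHom.id K)) (g i.1)

open Classical in
/-- The section `E_V̂ → E_V^♡` of the contraction map for which all `h_k` act by the identity. -/
def inflate {ν : (contract hC).Dim} (x : (contract hC).RepSpace K ν) :
    Q.RepSpace K (extDim hC ν) :=
  ⟨fun l => if h : Q.aE.SameCycle e l then castM (extDim_tgt_eq_src hC ν h) rfl 1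
    else x.mat ⟨l, h⟩⟩

theorem inflate_of_sameCycle {ν : (contract hC).Dim} (x : (contract hC).RepSpace K ν) {l : Ω}
    (h : Q.aE.SameCycle e l) :
    (inflate hC x).mat l = castM (extDim_tgt_eq_src hC ν h) rfl 1 :=
  dif_pos h

theorem inflate_of_not_sameCycle {ν : (contract hC).Dim} (x : (contract hC).RepSpace K ν) {l : Ω}
    (h : ¬ Q.aE.SameCycle e l) : (inflate hC x).mat l = x.mat ⟨l, h⟩ :=
  dif_neg h

theorem inflate_injective {ν : (contract hC).Dim} :
    Function.Injective (inflate (K := K) hC (ν := ν)) := fun x y hxy =>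
  RepSpace.ext <| funext fun l => by
    have := congrFun (congrArg RepSpace.mat hxy) l.1
    rwa [inflate_of_not_sameCycle hC x l.2, inflate_of_not_sameCycle hC y l.2] at this

/-- The content is `g g⁻¹ = 1`. The vertices are replaced by free variables of an arbitrary type so
that `a = b` can be substituted in the dependent sizes. -/
theorem mul_castM_one_mul_inv {α : Type*} {r : α → ℕ} (g : ∀ a, GL (Fin (r a)) K) {a b : α}
    (hab : a = b) (h : r a = r b) :
    (g a).1 * castM h rfl (1 : Matrix (Fin (r b)) (Fin (r b)) K) * ((g b)⁻¹).1 = castM h rfl 1 := by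
  subst hab
  rw [castM_one, Matrix.mul_one, Units.mul_inv]

/-- At a contracted edge, `diag` puts the same group element at both ends, so the identity is
conjugated to itself. -/
theorem inflate_smul {ν : (contract hC).Dim} (g : (contract hC).Grp K ν)
    (x : (contract hC).RepSpace K ν) :
    inflate hC (g • x) = diag hC ν g • inflate hC x := RepSpace.ext <| funext fun l => by
  by_cases h : Q.aE.SameCycle e l
  · rw [smul_apply, inflate_of_sameCycle hC _ h, inflate_of_sameCycle hC _ h]
    exact (mul_castM_one_mul_inv g (fold_tgt_eq_fold_src hC h) _).symm
  · rw [smul_apply, inflate_of_not_sameCycle hC _ h, inflate_of_not_sameCycle hC _ h]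
    rfl

theorem castM_castM_one {m n m' n' : ℕ} (h : m = n) (h₁ : m' = m) (h₂ : n' = n) (h₃ : m' = n') :
    castM h₁ h₂ ((castM h rfl (1 : Matrix (Fin n) (Fin n) K)).map φ) = castM h₃ rfl 1 := by
  subst h h₁ h₂
  exact Matrix.map_one φ (map_zero φ) (map_one φ)

/-- The automorphism permutes the `h_k` among themselves and the Frobenius fixes the entries of an
identity matrix. -/
theorem inflate_frob {ν : (contract hC).Dim} (x : (contract hC).RepSpace K ν) :
    inflate hC (frob φ x) = frob φ (inflate hC x) := RepSpace.ext <| funext fun l => by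
  by_cases h : Q.aE.SameCycle e l
  · have h' : Q.aE.SameCycle e (Q.aE l) := Equiv.Perm.sameCycle_apply_right.2 h
    rw [inflate_of_sameCycle hC _ h, frob]
    dsimp only
    rw [inflate_of_sameCycle hC _ h', castM_castM_one]
  · have h' : ¬ Q.aE.SameCycle e (Q.aE l) := fun h' => h (Equiv.Perm.sameCycle_apply_right.1 h')
    rw [inflate_of_not_sameCycle hC _ h, frob, frob]
    dsimp only
    rw [inflate_of_not_sameCycle hC _ h']
    rfl

theorem inflate_mem_heart {ν : (contract hC).Dim} (x : (contract hC).RepSpace K ν) :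
    inflate hC x ∈ heart e (extDim hC ν) := fun h hh => by
  rw [inflate_of_sameCycle hC _ hh]
  have : ∀ {m n : ℕ} (h : m = n),
      Function.Bijective (castM h rfl (1 : Matrix (Fin n) (Fin n) K)).mulVec := by
    rintro m n rfl
    rw [castM_one]
    exact ⟨fun v w hvw => by simpa using hvw, fun v => ⟨v, by simp⟩⟩
  exact this _

theorem legMat_inflate {ν : (contract hC).Dim} (x : (contract hC).RepSpace K ν) {i : ι}
    (hi : i ∈ Q.orbit (Q.tgt e)) : legMat hC (inflate hC x) hi = 1 := by
  rw [legMat, inflate_of_sameCycle hC _ (Q.leg_sameCycle e hi), castM_castM, castM_one]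

theorem contractMat_inflate {ν : (contract hC).Dim} (x : (contract hC).RepSpace K ν) {l : Ω} :
    contractMat hC (inflate hC x) l = (inflate hC x).mat l := by
  rw [contractMat]
  split_ifs with h₁ h₂
  · rw [legMat_inflate, Matrix.mul_one]
  · rw [legMat_inflate, inv_one, Matrix.one_mul]
  · rfl

theorem contractMap_inflate {ν : (contract hC).Dim} (x : (contract hC).RepSpace K ν) :
    contractMap hC (inflate hC x) = x := RepSpace.ext <| funext fun l =>
  (contractMat_inflate hC x).trans (inflate_of_not_sameCycle hC x l.2)

/-! ### Points of the locus `E_V^♡` as translates of inflated points -/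

theorem isUnit_castM {m n m' n' : ℕ} (h₁ : m' = m) (h₂ : n' = n) (h : m' = n')
    {A : Matrix (Fin m) (Fin n) K} (hA : Function.Bijective A.mulVec) :
    IsUnit (castM rfl h (castM h₁ h₂ A)) := by
  subst h₁ h₂ h
  exact Matrix.mulVec_injective_iff_isUnit.1 hA.1

theorem isUnit_legMat {ν : (contract hC).Dim} {x : Q.RepSpace K (extDim hC ν)}
    (hx : x ∈ heart e (extDim hC ν)) {i : ι} (hi : i ∈ Q.orbit (Q.tgt e)) :
    IsUnit (legMat hC x hi) :=
  isUnit_castM _ _ rfl (hx _ (Q.leg_sameCycle e hi))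

/-- There are no loops at `[i₋]`, and admissibility forbids other edges inside one orbit. So at most
one of the two corrections in `contractMat` applies to a given edge. -/
theorem tgt_notMem_of_src_mem {l : Ω} (h : Q.src l ∈ Q.orbit (Q.tgt e))
    (hC : Q.IsContractible e) : Q.tgt l ∉ Q.orbit (Q.tgt e) := fun h' => by
  by_cases hl : Q.src l = Q.tgt l
  · exact src_ne_of_loops hC.loops_tgt h l rfl hl.symm
  · exact Q.admissible _ hl (h.symm.trans h')

/-- Every point of `E_V^♡` is in the orbit of the inflation of its contraction. -/
theorem exists_smul_inflate {ν : (contract hC).Dim} {x : Q.RepSpace K (extDim hC ν)}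
    (hx : x ∈ heart e (extDim hC ν)) : ∃ t : Q.Grp K (extDim hC ν),
      t • inflate hC (contractMap hC x) = x ∧ (frob φ x = x → frobG φ t = t) := by
  classical
  -- At `i = h_k''` the group element is `x_{h_k}` itself, which turns the identity into `x_{h_k}`
  -- and undoes the correction of the other edges at `i`; elsewhere it is trivial.
  let t : Q.Grp K (extDim hC ν) := fun i =>
    if hi : i ∈ Q.orbit (Q.tgt e) then (isUnit_legMat hC hx hi).unit else 1
  have ht : ∀ {i} (hi : i ∈ Q.orbit (Q.tgt e)), (t i).1 = legMat hC x hi := fun hi => by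
    simp only [t, dif_pos hi]; rfl
  have ht' : ∀ {i}, i ∉ Q.orbit (Q.tgt e) → t i = 1 := fun hi => by simp only [t, dif_neg hi]
  refine ⟨t, ?_, fun hF => funext fun i => ?_⟩
  · refine RepSpace.ext <| funext fun l => ?_
    rw [smul_apply]
    by_cases hl : Q.aE.SameCycle e l
    · rw [inflate_of_sameCycle hC _ hl, ht' (hC.disjoint (src_mem hl)), ht (tgt_mem hl), inv_one,
        Units.val_one, Matrix.mul_one, legMat]
      have : ∀ {m n m' n' : ℕ} (A : Matrix (Fin m) (Fin n) K) (h₁ : m' = m) (h₂ : m' = n)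
          (h₃ : m' = n'), castM h₁ h₂ A * castM h₃ rfl (1 : Matrix (Fin n') (Fin n') K) =
            castM h₁ (h₃.symm.trans h₂) A := by
        rintro m n m' n' A rfl rfl rfl
        rw [castM_one, Matrix.mul_one]
      rw [this]
      exact castM_family x.mat (hC.eq_of_tgt (Q.leg_sameCycle e (tgt_mem hl)) hl
        (Q.tgt_leg e (tgt_mem hl))) _ _ rfl rfl
    · rw [inflate_of_not_sameCycle hC _ hl]
      show (t (Q.tgt l)).1 * contractMat hC x l * ((t (Q.src l))⁻¹).1 = x.mat l
      by_cases h₁ : Q.src l ∈ Q.orbit (Q.tgt e)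
      · rw [contractMat, dif_pos h₁, ht' (tgt_notMem_of_src_mem h₁ hC), Units.val_one,
          Matrix.one_mul, ← ht h₁, Matrix.mul_assoc, Units.mul_inv, Matrix.mul_one]
      · rw [contractMat, dif_neg h₁, ht' h₁, inv_one, Units.val_one, Matrix.mul_one]
        by_cases h₂ : Q.tgt l ∈ Q.orbit (Q.tgt e)
        · rw [dif_pos h₂, ← ht h₂, ← Matrix.coe_units_inv, ← Matrix.mul_assoc, Units.mul_inv,
            Matrix.one_mul]
        · rw [dif_neg h₂, ht' h₂, Units.val_one, Matrix.one_mul]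
  -- If `x` is fixed by `F`, so is the family of its matrices `x_{h_k}`, hence so is `t`.
  · refine Units.ext ?_
    rw [frobG_apply]
    by_cases hi : i ∈ Q.orbit (Q.tgt e)
    · have := legMat_frob hC φ x rfl hi (aV_mem_orbit.2 hi) (by rw [Q.orb_aV])
      rw [hF] at this
      rw [ht hi, ht (aV_mem_orbit.2 hi), this]
    · rw [ht' hi, ht' (fun h => hi (aV_mem_orbit.1 h)), Units.val_one, Units.val_one,
        Matrix.map_one φ (map_zero φ) (map_one φ), castM_one]

end inflation

/-! ### Inflation and the induction diagram -/

section inflationSum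

variable {ι Ω : Type*} {Q : AdmissibleQuiver ι Ω} [Finite ι] [Finite Ω] {e : Ω}
variable (hC : Q.IsContractible e) {K : Type*} [Field K] (φ : K →+* K)
variable {τ ω : (contract hC).Dim}

/-- The map `diag` for a sum of dimension vectors. -/
def diagSum (τ ω : (contract hC).Dim) :
    (contract hC).Grp K (τ + ω) →* Q.Grp K (extDim hC τ + extDim hC ω) := diag hC (τ + ω)

/-- The map `projG` for a sum of dimension vectors. -/
def projSum (g : Q.Grp K (extDim hC τ + extDim hC ω)) : (contract hC).Grp K (τ + ω) :=
  projG hC (ν := τ + ω) g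

/-- The map `inflate` for a sum of dimension vectors. -/
def inflateSum (x : (contract hC).RepSpace K (τ + ω)) :
    Q.RepSpace K (extDim hC τ + extDim hC ω) := inflate hC x

/-- The vectors `extDim hC (τ + ω)` and `extDim hC τ + extDim hC ω` are equal by definition but not
syntactically. The facts about `diag`, `projG` and `inflate` are restated over the second form,
where the decomposition `V = T ⊕ W` is visible. -/
theorem projSum_diagSum (g : (contract hC).Grp K (τ + ω)) :
    projSum hC (diagSum hC τ ω g) = g := projG_diag hC g

theorem projSum_mul (g g' : Q.Grp K (extDim hC τ + extDim hC ω)) :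
    projSum hC (g * g') = projSum hC g * projSum hC g' := projG_mul hC (ν := τ + ω) g g'

theorem projSum_inv (g : Q.Grp K (extDim hC τ + extDim hC ω)) :
    projSum hC g⁻¹ = (projSum hC g)⁻¹ := projG_inv hC (ν := τ + ω) g

theorem diagSum_projSum_apply (g : Q.Grp K (extDim hC τ + extDim hC ω)) {i : ι}
    (hi : i ∉ Q.orbit (Q.tgt e)) : diagSum hC τ ω (projSum hC g) i = g i :=
  diag_projG_apply hC (ν := τ + ω) g hi

theorem diagSum_frobG (g : (contract hC).Grp K (τ + ω)) :
    diagSum hC τ ω (frobG φ g) = frobG φ (diagSum hC τ ω g) := diag_frobG hC φ g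

theorem inflateSum_injective : Function.Injective (inflateSum (K := K) hC (τ := τ) (ω := ω)) :=
  inflate_injective hC

theorem inflateSum_smul (g : (contract hC).Grp K (τ + ω)) (x : (contract hC).RepSpace K (τ + ω)) :
    inflateSum hC (g • x) = diagSum hC τ ω g • inflateSum hC x := inflate_smul hC g x

theorem inflateSum_frob (x : (contract hC).RepSpace K (τ + ω)) :
    inflateSum hC (frob φ x) = frob φ (inflateSum hC x) := inflate_frob hC φ x

theorem mapsW_castM_one {a b c d : ℕ} (h₁ : a = c) (h₂ : b = d) (h : a + b = c + d) :
    MapsW a b c d (castM h rfl (1 : Matrix (Fin (c + d)) (Fin (c + d)) K)) := by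
  subst h₁ h₂
  exact mapsW_one a b

theorem blockT_castM_one {a b c d : ℕ} (h₁ : a = c) (h₂ : b = d) (h : a + b = c + d) :
    blockT a b c d (castM h rfl (1 : Matrix (Fin (c + d)) (Fin (c + d)) K)) =
      castM h₁ rfl 1 := by
  subst h₁ h₂
  exact blockT_one a b

theorem blockW_castM_one {a b c d : ℕ} (h₁ : a = c) (h₂ : b = d) (h : a + b = c + d) :
    blockW a b c d (castM h rfl (1 : Matrix (Fin (c + d)) (Fin (c + d)) K)) =
      castM h₂ rfl 1 := by
  subst h₁ h₂
  exact blockW_one a b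

theorem partT_inflateSum (x : (contract hC).RepSpace K (τ + ω)) :
    partT (inflateSum hC x) = inflate hC (partT x) := RepSpace.ext <| funext fun l => by
  by_cases h : Q.aE.SameCycle e l
  · rw [inflate_of_sameCycle hC _ h]
    refine (congrArg (blockT _ _ _ _) (inflate_of_sameCycle hC x h)).trans ?_
    exact blockT_castM_one (extDim_tgt_eq_src hC τ h) (extDim_tgt_eq_src hC ω h) _
  · rw [inflate_of_not_sameCycle hC _ h]
    exact congrArg (blockT _ _ _ _) (inflate_of_not_sameCycle hC x h)

theorem partW_inflateSum (x : (contract hC).RepSpace K (τ + ω)) :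
    partW (inflateSum hC x) = inflate hC (partW x) := RepSpace.ext <| funext fun l => by
  by_cases h : Q.aE.SameCycle e l
  · rw [inflate_of_sameCycle hC _ h]
    refine (congrArg (blockW _ _ _ _) (inflate_of_sameCycle hC x h)).trans ?_
    exact blockW_castM_one (extDim_tgt_eq_src hC τ h) (extDim_tgt_eq_src hC ω h) _
  · rw [inflate_of_not_sameCycle hC _ h]
    exact congrArg (blockW _ _ _ _) (inflate_of_not_sameCycle hC x h)

/-- Inflation of representations that leave `W` invariant. -/
def inflateStab (x : StabSpace (Q := contract hC) K τ ω) :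
    StabSpace (Q := Q) K (extDim hC τ) (extDim hC ω) :=
  ⟨inflateSum hC x.1, fun l => by
    by_cases h : Q.aE.SameCycle e l
    · refine (congrArg (MapsW _ _ _ _) (inflate_of_sameCycle hC x.1 h)).mpr ?_
      exact mapsW_castM_one (extDim_tgt_eq_src hC τ h) (extDim_tgt_eq_src hC ω h) _
    · exact (congrArg (MapsW _ _ _ _) (inflate_of_not_sameCycle hC x.1 h)).mpr (x.2 ⟨l, h⟩)⟩

theorem mapsW_of_inflateSum {x : (contract hC).RepSpace K (τ + ω)}
    (hx : ∀ h, MapsW (extDim hC τ (Q.orb (Q.tgt h))) (extDim hC ω (Q.orb (Q.tgt h)))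
      (extDim hC τ (Q.orb (Q.src h))) (extDim hC ω (Q.orb (Q.src h))) ((inflateSum hC x).mat h))
    (l : Q.CEdge e) : MapsW (τ ((contract hC).orb ((contract hC).tgt l)))
      (ω ((contract hC).orb ((contract hC).tgt l))) (τ ((contract hC).orb ((contract hC).src l)))
      (ω ((contract hC).orb ((contract hC).src l))) (x.mat l) :=
  (congrArg (MapsW _ _ _ _) (inflate_of_not_sameCycle hC x l.2)).mp (hx l.1)

theorem diagSum_mem_parabolic {b : (contract hC).Grp K (τ + ω)} (hb : b ∈ parabolic K τ ω) :
    diagSum hC τ ω b ∈ parabolic K (extDim hC τ) (extDim hC ω) := fun i => hb (fold hC i)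

theorem diagSum_mem_unipotent {b : (contract hC).Grp K (τ + ω)} (hb : b ∈ unipotent K τ ω) :
    diagSum hC τ ω b ∈ unipotent K (extDim hC τ) (extDim hC ω) :=
  ⟨diagSum_mem_parabolic hC hb.1, fun i => hb.2 (fold hC i)⟩

theorem projSum_mem_parabolic {b : Q.Grp K (extDim hC τ + extDim hC ω)}
    (hb : b ∈ parabolic K (extDim hC τ) (extDim hC ω)) : projSum hC b ∈ parabolic K τ ω :=
  fun i => by
  refine ⟨(hb i.1).1.castM (extDim_val hC τ i) (extDim_val hC ω i) (extDim_val hC τ i)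
    (extDim_val hC ω i) _ _ (RingHom.id K), ?_⟩
  rw [← Pi.inv_apply, ← projSum_inv]
  exact (hb i.1).2.castM (extDim_val hC τ i) (extDim_val hC ω i) (extDim_val hC τ i)
    (extDim_val hC ω i) _ _ (RingHom.id K)

theorem projSum_mem_unipotent {b : Q.Grp K (extDim hC τ + extDim hC ω)}
    (hb : b ∈ unipotent K (extDim hC τ) (extDim hC ω)) : projSum hC b ∈ unipotent K τ ω := by
  refine ⟨projSum_mem_parabolic hC hb.1, fun i => ⟨?_, ?_⟩⟩
  · refine (blockT_castM (extDim_val hC τ i) (extDim_val hC ω i) (extDim_val hC τ i)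
      (extDim_val hC ω i) _ _ (b i.1).1 (RingHom.id K)).trans ?_
    rw [(hb.2 i.1).1, Matrix.map_one _ (map_zero _) (map_one _), castM_one]
  · refine (blockW_castM (extDim_val hC τ i) (extDim_val hC ω i) (extDim_val hC τ i)
      (extDim_val hC ω i) _ _ (b i.1).1 (RingHom.id K)).trans ?_
    rw [(hb.2 i.1).2, Matrix.map_one _ (map_zero _) (map_one _), castM_one]

/-- The map `Ê' → E'`, `[g, y] ↦ [g l, l⁻¹.y]`, for `l` in the Levi subgroup. -/
def inflateE' (l : Q.Grp K (extDim hC τ) × Q.Grp K (extDim hC ω)) :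
    EPrime (Q := contract hC) K τ ω → EPrime (Q := Q) K (extDim hC τ) (extDim hC ω) :=
  Quotient.map (fun z => (diagSum hC τ ω z.1 * levi _ _ l,
    ⟨(levi _ _ l)⁻¹ • (inflateStab hC z.2).1,
      smul_mapsW (inv_mem (levi_mem l)) (inflateStab hC z.2).2⟩)) fun z z' ⟨b, hb, h1, h2⟩ =>
    ⟨(levi _ _ l)⁻¹ * diagSum hC τ ω b * levi _ _ l,
      levi_inv_mul_mul_mem l (diagSum_mem_unipotent hC hb), by
        dsimp only
        rw [h1, map_mul, map_inv]; group, by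
        show (levi _ _ l)⁻¹ • inflateSum hC z'.2.1 = _ • (levi _ _ l)⁻¹ • inflateSum hC z.2.1
        rw [h2, inflateSum_smul, ← mul_smul, ← mul_smul]
        congr 1; group⟩

/-- The map `Ê'' → E''`, `[g, y] ↦ [g, y]`. -/
def inflateE'' :
    EDoublePrime (Q := contract hC) K τ ω →
      EDoublePrime (Q := Q) K (extDim hC τ) (extDim hC ω) :=
  Quotient.map (fun z => (diagSum hC τ ω z.1, inflateStab hC z.2)) fun z z' ⟨b, hb, h1, h2⟩ =>
    ⟨diagSum hC τ ω b, diagSum_mem_parabolic hC hb, by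
        dsimp only
        rw [h1, map_mul, map_inv], by
        show inflateSum hC z'.2.1 = _ • inflateSum hC z.2.1
        rw [h2, inflateSum_smul]⟩

theorem p₂_inflateE' (l : Q.Grp K (extDim hC τ) × Q.Grp K (extDim hC ω))
    (z : EPrime (Q := contract hC) K τ ω) : p₂ (inflateE' hC l z) = inflateE'' hC (p₂ z) := by
  obtain ⟨z⟩ := z
  refine Quotient.sound ⟨levi _ _ l, levi_mem l, ?_, ?_⟩
  · exact (mul_inv_cancel_right _ _).symm
  · exact (smul_inv_smul _ _).symm

theorem p₃_inflateE'' (w : EDoublePrime (Q := contract hC) K τ ω) :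
    p₃ (inflateE'' hC w) = inflateSum hC (p₃ w) := by
  obtain ⟨z⟩ := w
  exact (inflateSum_smul hC _ _).symm

theorem p₁T_inflateE' (l : Q.Grp K (extDim hC τ) × Q.Grp K (extDim hC ω))
    (z : EPrime (Q := contract hC) K τ ω) :
    p₁T (inflateE' hC l z) = l.1⁻¹ • inflate hC (p₁T z) := by
  obtain ⟨z⟩ := z
  show partT ((levi _ _ l)⁻¹ • (inflateStab hC z.2).1) = l.1⁻¹ • inflate hC (partT z.2.1)
  rw [← map_inv, partT_levi_smul _ (inflateStab hC z.2).2]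
  exact congrArg _ (partT_inflateSum hC _)

theorem p₁W_inflateE' (l : Q.Grp K (extDim hC τ) × Q.Grp K (extDim hC ω))
    (z : EPrime (Q := contract hC) K τ ω) :
    p₁W (inflateE' hC l z) = l.2⁻¹ • inflate hC (p₁W z) := by
  obtain ⟨z⟩ := z
  show partW ((levi _ _ l)⁻¹ • (inflateStab hC z.2).1) = l.2⁻¹ • inflate hC (partW z.2.1)
  rw [← map_inv, partW_levi_smul _ (inflateStab hC z.2).2]
  exact congrArg _ (partW_inflateSum hC _)

/-- Applying `F` also moves the parameter `l`. Together with `inflateE'_injective` this shows that a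
point `inflateE' l z` is `F`-fixed only if `l` and `z` are, for `l` in the kernel. -/
theorem frobE'_inflateE' (l : Q.Grp K (extDim hC τ) × Q.Grp K (extDim hC ω))
    (z : EPrime (Q := contract hC) K τ ω) : frobE' φ (inflateE' hC l z) =
      inflateE' hC (frobG φ l.1, frobG φ l.2) (frobE' φ z) := by
  obtain ⟨z⟩ := z
  refine congrArg (Quotient.mk _) (Prod.ext ?_ (Subtype.ext ?_))
  · show frobG φ (diagSum hC τ ω z.1 * levi _ _ l) = diagSum hC τ ω (frobG φ z.1) * _
    rw [map_mul, frobG_levi, diagSum_frobG]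
  · show frob φ ((levi _ _ l)⁻¹ • inflateSum hC z.2.1) = _ • inflateSum hC (frob φ z.2.1)
    rw [frob_smul, inflateSum_frob, map_inv, frobG_levi]

theorem frobE''_inflateE'' (w : EDoublePrime (Q := contract hC) K τ ω) :
    frobE'' φ (inflateE'' hC w) = inflateE'' hC (frobE'' φ w) := by
  obtain ⟨z⟩ := w
  refine congrArg (Quotient.mk _) (Prod.ext ?_ (Subtype.ext ?_))
  · exact (diagSum_frobG hC φ _).symm
  · exact (inflateSum_frob hC φ _).symm

/-- Projecting the element that relates two images gives an element of the contracted parabolic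
relating the group components. The representation components then match because `p₃` takes the same
value on both classes, so the second half of the orbit relation is not needed. -/
theorem inflateE''_injective :
    Function.Injective (inflateE'' (K := K) hC (τ := τ) (ω := ω)) := by
  rintro ⟨z⟩ ⟨z'⟩ h
  have h3 : z.1 • z.2.1 = z'.1 • z'.2.1 := inflateSum_injective hC
    ((p₃_inflateE'' hC _).symm.trans ((congrArg p₃ h).trans (p₃_inflateE'' hC _)))
  obtain ⟨b, hb, h1, -⟩ := Quotient.exact h
  have h1' : z'.1 = z.1 * (projSum hC b)⁻¹ := by
    have := congrArg (projSum hC) h1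
    rwa [projSum_mul, projSum_inv, projSum_diagSum, projSum_diagSum] at this
  refine Quotient.sound ⟨projSum hC b, projSum_mem_parabolic hC hb, h1', ?_⟩
  rw [h1', mul_smul, smul_left_cancel_iff] at h3
  rw [h3, smul_inv_smul]

theorem projSum_levi (l : Q.Grp K (extDim hC τ) × Q.Grp K (extDim hC ω))
    (h₁ : projG hC l.1 = 1) (h₂ : projG hC l.2 = 1) : projSum hC (levi _ _ l) = 1 := by
  funext i
  refine Units.ext ?_
  refine (castM_leviMat (extDim_val hC τ i) (extDim_val hC ω i) _ _ _ _ (RingHom.id K)).trans ?_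
  have e₁ := congrArg Units.val (congrFun h₁ i)
  have e₂ := congrArg Units.val (congrFun h₂ i)
  refine (congrArg₂ (leviMat _ _) e₁ e₂).trans ?_
  exact leviMat_one _ _

/-- The two classes are matched as for `inflateE''`, since `l` and `l'` become trivial under the
projection. What remains is an equation between `levi l` and `levi l'` up to unipotent factors, and
these factors do not affect the diagonal blocks. -/
theorem inflateE'_injective {l l' : Q.Grp K (extDim hC τ) × Q.Grp K (extDim hC ω)}
    (h₁ : projG hC l.1 = 1) (h₂ : projG hC l.2 = 1) (h₁' : projG hC l'.1 = 1)
    (h₂' : projG hC l'.2 = 1) {z z' : EPrime (Q := contract hC) K τ ω}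
    (h : inflateE' hC l z = inflateE' hC l' z') : l = l' ∧ z = z' := by
  obtain ⟨z⟩ := z
  obtain ⟨z'⟩ := z'
  have h3 : z.1 • z.2.1 = z'.1 • z'.2.1 := inflateSum_injective hC (by
    have := (p₂_inflateE' hC l _).symm.trans ((congrArg p₂ h).trans (p₂_inflateE' hC l' _))
    exact (p₃_inflateE'' hC _).symm.trans ((congrArg p₃ this).trans (p₃_inflateE'' hC _)))
  obtain ⟨b, hb, h1, -⟩ := Quotient.exact h
  change diagSum hC τ ω z'.1 * levi _ _ l' = diagSum hC τ ω z.1 * levi _ _ l * b⁻¹ at h1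
  have h1' : z'.1 = z.1 * (projSum hC b)⁻¹ := by
    have := congrArg (projSum hC) h1
    rwa [projSum_mul, projSum_mul, projSum_mul, projSum_inv, projSum_diagSum, projSum_diagSum,
      projSum_levi hC l h₁ h₂, projSum_levi hC l' h₁' h₂', mul_one, mul_one] at this
  have hb' := projSum_mem_unipotent hC hb
  refine ⟨?_, Quotient.sound ⟨projSum hC b, hb', h1', ?_⟩⟩
  -- After cancellation the equation is `d⁻¹ levi l' = levi l b⁻¹`, where `d` is the diagonal copy
  -- of the projection of `b`; both `d` and `b` are unipotent.
  · rw [h1', map_mul, map_inv, mul_assoc, mul_assoc, mul_right_inj] at h1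
    have hd := inv_mem (diagSum_mem_unipotent hC hb')
    refine Prod.ext (funext fun i => Units.ext ?_) (funext fun i => Units.ext ?_)
    · have := congrArg (fun g => blockT (extDim hC τ (Q.orb i)) (extDim hC ω (Q.orb i))
        (extDim hC τ (Q.orb i)) (extDim hC ω (Q.orb i)) (g i).1) h1
      have e1 := blockT_mul (B := (levi (K := K) _ _ l' i).1) (hd.1 i).1
      have e2 := blockT_mul (B := (b⁻¹ i).1) (levi_mem l i).1
      rw [(hd.2 i).1, Matrix.one_mul, blockT_levi] at e1
      rw [((inv_mem hb).2 i).1, Matrix.mul_one, blockT_levi] at e2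
      exact (e1.symm.trans (this.trans e2)).symm
    · have := congrArg (fun g => blockW (extDim hC τ (Q.orb i)) (extDim hC ω (Q.orb i))
        (extDim hC τ (Q.orb i)) (extDim hC ω (Q.orb i)) (g i).1) h1
      have e1 := blockW_mul (A := ((diagSum hC τ ω (projSum hC b))⁻¹ i).1) (levi_mem l' i).1
      have e2 := blockW_mul (A := (levi (K := K) _ _ l i).1) ((inv_mem hb).1 i).1
      rw [(hd.2 i).2, Matrix.one_mul, blockW_levi] at e1
      rw [((inv_mem hb).2 i).2, Matrix.mul_one, blockW_levi] at e2
      exact (e1.symm.trans (this.trans e2)).symm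
  · rw [h1', mul_smul, smul_left_cancel_iff] at h3
    rw [h3, smul_inv_smul]

/-! ### The fibre of `p₃ ∘ p₂` over an inflated representation -/

theorem mapsW_castM_of_eq {a b c d a' b' c' d' : ℕ} (ha : a' = a) (hb : b' = b) (hc : c' = c)
    (hd : d' = d) (h₁ : a' + b' = a + b) (h₂ : c' + d' = c + d)
    {A : Matrix (Fin (a + b)) (Fin (c + d)) K} (hA : MapsW a b c d A) :
    MapsW a' b' c' d' (castM h₁ h₂ A) := by
  subst ha hb hc hd
  exact hA

/-- For `i = h_k''` the action gives `1 = g_i y_{h_k} g_{h_k'}⁻¹`, so `g_i⁻¹ g_{h_k'}` is `y_{h_k}`.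
-/
theorem inv_mul_diag_apply {ν : (contract hC).Dim} {g : Q.Grp K (extDim hC ν)}
    {y : Q.RepSpace K (extDim hC ν)} {x : (contract hC).RepSpace K ν}
    (h : g • y = inflate hC x) {i : ι} (hi : i ∈ Q.orbit (Q.tgt e)) :
    ((g⁻¹ * diag hC ν (projG hC g)) i).1 = legMat hC y hi := by
  have h1 := legMat_smul hC g y hi
  rw [h, legMat_inflate] at h1
  have h2 : (g i).1 * legMat hC y hi = (diag hC ν (projG hC g) i).1 := by
    have h3 : castM (extDim_fold hC ν i) (extDim_fold hC ν i) ((g (fold hC i).1)⁻¹).1 *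
        (diag hC ν (projG hC g) i).1 = 1 :=
      (castM_mul _ _ _ _ _).symm.trans
        ((congrArg (castM _ _) (Units.inv_mul _)).trans (castM_one _ _))
    rw [← Matrix.one_mul (diag hC ν (projG hC g) i).1, h1, Matrix.mul_assoc _ _ (Units.val _), h3,
      Matrix.mul_one]
  rw [Pi.mul_apply, Units.val_mul, ← h2, ← Matrix.mul_assoc]
  exact (congrArg (· * _) (Units.inv_mul (g i))).trans (Matrix.one_mul _)

/-- The quotient of `g` by its diagonal approximation is `y_{h_k}` at `h_k''` and trivial elsewhere,
and `y` preserves `W`. In geometric terms, the subspace `gW` has the same components at the two ends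
of `h_k`. -/
theorem mapsW_inv_mul_diagSum {g : Q.Grp K (extDim hC τ + extDim hC ω)}
    {y : StabSpace (Q := Q) K (extDim hC τ) (extDim hC ω)}
    {x : (contract hC).RepSpace K (τ + ω)} (h : g • y.1 = inflateSum hC x) (i : ι) :
    MapsW (extDim hC τ (Q.orb i)) (extDim hC ω (Q.orb i)) (extDim hC τ (Q.orb i))
      (extDim hC ω (Q.orb i)) ((g⁻¹ * diagSum hC τ ω (projSum hC g)) i).1 := by
  by_cases hi : i ∈ Q.orbit (Q.tgt e)
  · have h4 := inv_mul_diag_apply hC (ν := τ + ω) h hi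
    refine (congrArg (MapsW _ _ _ _) h4).mpr ?_
    exact mapsW_castM_of_eq (extDim_tgt_leg hC τ hi) (extDim_tgt_leg hC ω hi)
      (extDim_leg hC τ hi) (extDim_leg hC ω hi) _ _ (y.2 _)
  · rw [Pi.mul_apply, diagSum_projSum_apply hC g hi, Pi.inv_apply, inv_mul_cancel]
    exact mapsW_one _ _

/-- The block triangular quotient `A = g⁻¹ diag(proj g)` factors as a unipotent `v` times the
inverse of a Levi element `l = (k, m)`. Hence `g = diag(proj g) l v⁻¹`, which presents the class of
`(g, y)` as an image under `inflateE' l`. As `A` is trivial off `[i₋]`, so is `l`, and `l` lies in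
the kernel. -/
theorem exists_inflateE' {z : EPrime (Q := Q) K (extDim hC τ) (extDim hC ω)}
    {x : (contract hC).RepSpace K (τ + ω)} (h : p₃ (p₂ z) = inflateSum hC x) :
    ∃ (l : Q.Grp K (extDim hC τ) × Q.Grp K (extDim hC ω)) (z' : EPrime (Q := contract hC) K τ ω),
      projG hC l.1 = 1 ∧ projG hC l.2 = 1 ∧ inflateE' hC l z' = z := by
  obtain ⟨g, y⟩ := z
  change g • y.1 = inflateSum hC x at h
  have hA := mapsW_inv_mul_diagSum hC h
  have hA1 : ∀ i, i ∉ Q.orbit (Q.tgt e) → (g⁻¹ * diagSum hC τ ω (projSum hC g)) i = 1 :=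
    fun i hi => by
      rw [Pi.mul_apply, diagSum_projSum_apply hC g hi, Pi.inv_apply, inv_mul_cancel]
  choose k m hv hv' hvT hvW hk hm using fun i => exists_mul_leviGL (hA i)
  let v := g⁻¹ * diagSum hC τ ω (projSum hC g) * levi _ _ (k, m)
  have hvu : v ∈ unipotent K (extDim hC τ) (extDim hC ω) :=
    ⟨fun i => ⟨hv i, hv' i⟩, fun i => ⟨hvT i, hvW i⟩⟩
  have hy : inflateSum hC ((projSum hC g)⁻¹ • x) = (levi _ _ (k, m) * v⁻¹) • y.1 := by
    rw [inflateSum_smul, ← h, ← mul_smul, map_inv]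
    congr 1
    simp only [v]
    group
  have hS := smul_mapsW (mul_mem (levi_mem (k, m)) (inv_mem hvu.1)) y.2
  rw [← hy] at hS
  refine ⟨(k, m), Quotient.mk _ (projSum hC g, ⟨_, mapsW_of_inflateSum hC hS⟩), ?_, ?_, ?_⟩
  · funext i
    have h1 : k i.1 = 1 := by
      have := hk i.1
      rw [hA1 i.1 i.2, Units.val_one] at this
      refine inv_eq_one.1 (Units.ext (this.symm.trans (blockT_one _ _)))
    exact (congrArg (glMap (extDim_val hC τ i) (RingHom.id K)) h1).trans (map_one _)
  · funext i
    have h1 : m i.1 = 1 := by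
      have := hm i.1
      rw [hA1 i.1 i.2, Units.val_one] at this
      refine inv_eq_one.1 (Units.ext (this.symm.trans (blockW_one _ _)))
    exact (congrArg (glMap (extDim_val hC ω i) (RingHom.id K)) h1).trans (map_one _)
  · refine Quotient.sound ⟨v, hvu, ?_, ?_⟩
    · show g = diagSum hC τ ω (projSum hC g) * levi _ _ (k, m) * v⁻¹
      simp only [v]
      group
    · show y.1 = v • (levi _ _ (k, m))⁻¹ • inflateSum hC ((projSum hC g)⁻¹ • x)
      rw [hy, ← mul_smul, ← mul_smul]
      simp

end inflationSum

/-! ### Comparison of the inductions -/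

/-- No finiteness of `X` is needed: if the support of `u` is infinite, so is that of its pullback,
because `L` is nonempty, and both sums take the default value zero. -/
theorem finsum_snd {L X R : Type*} [Finite L] [Nonempty L] [Field R] (u : X → R) :
    ∑ᶠ z : L × X, u z.2 = (Nat.card L : R) * ∑ᶠ x, u x := by
  by_cases hu : (Function.support u).Finite
  · have h : (Function.support fun z : L × X => u z.2).Finite :=
      (Set.finite_univ.prod hu).subset fun z hz => ⟨trivial, hz⟩
    have := Fintype.ofFinite L
    rw [finsum_curry _ h]
    dsimp only
    rw [finsum_eq_sum_of_fintype, Finset.sum_const, nsmul_eq_mul, Nat.card_eq_fintype_card]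
    rfl
  · have h : ¬ (Function.support fun z : L × X => u z.2).Finite := fun h =>
      hu ((h.image Prod.snd).subset fun x hx => ⟨(Classical.arbitrary L, x), hx, rfl⟩)
    rw [finsum_of_infinite_support hu, finsum_of_infinite_support h, mul_zero]

/-- `m` identifies `L` times the fibre of `f'` over `y` with the fibre of `f` over `n y`.
Surjectivity is asked only over the point `n y` in question, since inflation does not reach the
other points. -/
theorem pushforward_eq_mul {L X Y X' Y' R : Type*} [Finite L] [Nonempty L] [Field R]
    {f : X → Y} {f' : X' → Y'} {u : X → R} {u' : X' → R} (m : L × X' → X) (n : Y' → Y) (c : R)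
    (hm : Function.Injective m) (hn : Function.Injective n) (hf : ∀ z, f (m z) = n (f' z.2))
    (hu : ∀ z, u (m z) = c * u' z.2) (y : Y') (hy : ∀ x, f x = n y → ∃ z, m z = x) :
    pushforward f u (n y) = Nat.card L * c * pushforward f' u' y := by
  let E : L × {x : X' // f' x = y} → {x : X // f x = n y} :=
    fun z => ⟨m (z.1, z.2.1), by rw [hf, z.2.2]⟩
  have hE : Function.Bijective E := by
    refine ⟨fun z z' h => ?_, fun x => ?_⟩
    · have : (z.1, z.2.1) = (z'.1, z'.2.1) := hm (congrArg Subtype.val h)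
      exact Prod.ext (Prod.mk.inj this).1 (Subtype.ext (Prod.mk.inj this).2)
    · obtain ⟨z, hz⟩ := hy x.1 x.2
      refine ⟨(z.1, ⟨z.2, hn ?_⟩), Subtype.ext hz⟩
      rw [← hf, hz, x.2]
  rw [pushforward, pushforward, ← finsum_comp E hE]
  simp only [E, hu]
  rw [finsum_snd (fun x : {x : X' // f' x = y} => c * u' x.1), mul_assoc]
  congr 1
  exact (smul_finsum c fun x : {x : X' // f' x = y} => u' x.1).symm

section compare

variable {ι Ω : Type*} {Q : AdmissibleQuiver ι Ω} [Finite ι] [Finite Ω] {e : Ω}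
variable (hC : Q.IsContractible e) {K : Type*} [Field K] (φ : K →+* K)

/-- The kernel of `G_V^F → G_V̂^F`. -/
abbrev KerF (ν : (contract hC).Dim) : Type _ :=
  {k : GrpF (Q := Q) φ (extDim hC ν) // projG hC k.1 = 1}

instance (ν : (contract hC).Dim) : Nonempty (KerF hC φ ν) :=
  ⟨⟨⟨1, map_one (frobG φ)⟩, projG_one hC⟩⟩

/-- `G_V^F` is the semidirect product of `G_V̂^F` and the kernel of the projection. -/
def grpFEquiv (ν : (contract hC).Dim) :
    GrpF (Q := Q) φ (extDim hC ν) ≃ GrpF (Q := contract hC) φ ν × KerF hC φ ν where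
  toFun g := (⟨projG hC g.1, by
      show frobG φ (projG hC g.1) = projG hC g.1
      rw [← projG_frob, show frobG φ g.1 = g.1 from g.2]⟩,
    ⟨⟨(diag hC ν (projG hC g.1))⁻¹ * g.1, by
      show frobG φ ((diag hC ν (projG hC g.1))⁻¹ * g.1) = (diag hC ν (projG hC g.1))⁻¹ * g.1
      rw [map_mul, map_inv, ← diag_frobG, ← projG_frob, show frobG φ g.1 = g.1 from g.2]⟩, by
      show projG hC ((diag hC ν (projG hC g.1))⁻¹ * g.1) = 1
      rw [projG_mul, projG_inv, projG_diag, inv_mul_cancel]⟩)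
  invFun z := ⟨diag hC ν z.1.1 * z.2.1.1, by
    show frobG φ (diag hC ν z.1.1 * z.2.1.1) = diag hC ν z.1.1 * z.2.1.1
    rw [map_mul, ← diag_frobG, show frobG φ z.1.1 = z.1.1 from z.1.2,
      show frobG φ z.2.1.1 = z.2.1.1 from z.2.1.2]⟩
  left_inv g := Subtype.ext (mul_inv_cancel_left _ _)
  right_inv z := by
    have h : projG hC (diag hC ν z.1.1 * z.2.1.1) = z.1.1 := by
      rw [projG_mul, projG_diag, z.2.2, mul_one]
    refine Prod.ext (Subtype.ext h) (Subtype.ext (Subtype.ext ?_))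
    show (diag hC ν (projG hC (diag hC ν z.1.1 * z.2.1.1)))⁻¹ * (diag hC ν z.1.1 * z.2.1.1) =
      z.2.1.1
    rw [h, inv_mul_cancel_left]

variable {τ ω : (contract hC).Dim}

/-- Inflation of `F`-fixed representations. -/
def inflateF (x : RepF (Q := contract hC) (K := K) φ (τ + ω)) :
    RepF (Q := Q) φ (extDim hC τ + extDim hC ω) :=
  fixMap (inflateSum hC) (inflateSum_frob hC φ) x

theorem contractMap_inv_smul_inflate {ν : (contract hC).Dim} {k : Q.Grp K (extDim hC ν)}
    (hk : projG hC k = 1) (y : (contract hC).RepSpace K ν) :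
    contractMap hC (k⁻¹ • inflate hC y) = y := by
  rw [contractMap_smul, projG_inv, hk, inv_one, one_smul, contractMap_inflate]

variable {R : Type*} [Field R]

/-- The inner push-forward contributes the order of the kernels, the outer one only a bijection of
fibres. The functions `F₁`, `F₂` enter only through their values on the loci `E_T^♡`, `E_W^♡`, since
`p₁ (inflateE' l z)` is a translate of an inflated point. -/
theorem rawInd_inflateF [Finite (KerF hC φ τ)] [Finite (KerF hC φ ω)]
    {F₁ : RepF (Q := Q) φ (extDim hC τ) → R} {F₂ : RepF (Q := Q) φ (extDim hC ω) → R}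
    {f₁ : RepF (Q := contract hC) φ τ → R} {f₂ : RepF (Q := contract hC) φ ω → R} (c₁ c₂ : R)
    (h₁ : ∀ y y', y.1 ∈ heart e (extDim hC τ) → contractMap hC y.1 = y'.1 → F₁ y = c₁ * f₁ y')
    (h₂ : ∀ y y', y.1 ∈ heart e (extDim hC ω) → contractMap hC y.1 = y'.1 → F₂ y = c₂ * f₂ y')
    (x : RepF (Q := contract hC) φ (τ + ω)) :
    rawInd φ F₁ F₂ (inflateF hC φ x) =
      Nat.card (KerF hC φ τ × KerF hC φ ω) * (c₁ * c₂) * rawInd φ f₁ f₂ x := by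
  let m : (KerF hC φ τ × KerF hC φ ω) × Function.fixedPoints (frobE' (K := K) φ
      (τ := τ) (ω := ω)) → Function.fixedPoints (frobE' (K := K) φ (τ := extDim hC τ)
        (ω := extDim hC ω)) := fun z => ⟨inflateE' hC (z.1.1.1.1, z.1.2.1.1) z.2.1, by
    show frobE' φ (inflateE' hC (z.1.1.1.1, z.1.2.1.1) z.2.1) = _
    rw [frobE'_inflateE', show frobE' φ z.2.1 = z.2.1 from z.2.2]
    dsimp only
    rw [show frobG φ z.1.1.1.1 = _ from z.1.1.1.2, show frobG φ z.1.2.1.1 = _ from z.1.2.1.2]⟩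
  let n : Function.fixedPoints (frobE'' (K := K) φ (τ := τ) (ω := ω)) →
      Function.fixedPoints (frobE'' (K := K) φ (τ := extDim hC τ) (ω := extDim hC ω)) :=
    fixMap (inflateE'' hC) fun w => (frobE''_inflateE'' hC φ w).symm
  have hm : Function.Injective m := fun z z' h => by
    obtain ⟨hl, hz⟩ := inflateE'_injective hC z.1.1.2 z.1.2.2 z'.1.1.2 z'.1.2.2
      (congrArg Subtype.val h)
    exact Prod.ext (Prod.ext (Subtype.ext (Subtype.ext (congrArg Prod.fst hl)))
      (Subtype.ext (Subtype.ext (congrArg Prod.snd hl)))) (Subtype.ext hz)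
  have hn : Function.Injective n := fun w w' h =>
    Subtype.ext (inflateE''_injective hC (congrArg Subtype.val h))
  have hp : ∀ z, fixMap p₂ (p₂_semiconj φ) (m z) = n (fixMap p₂ (p₂_semiconj φ) z.2) :=
    fun z => Subtype.ext (p₂_inflateE' hC _ _)
  have hsurj : ∀ z : Function.fixedPoints (frobE' (K := K) φ (τ := extDim hC τ)
      (ω := extDim hC ω)), ∀ x : (contract hC).RepSpace K (τ + ω),
      p₃ (p₂ z.1) = inflateSum hC x → ∃ w, m w = z := by
    intro z x hz
    obtain ⟨l, z', hl₁, hl₂, h⟩ := exists_inflateE' hC hz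
    -- The decomposition of an `F`-fixed point was found without regard to `F`; by uniqueness its
    -- ingredients are `F`-fixed.
    have hz' : frobE' φ (inflateE' hC l z') = inflateE' hC l z' := by
      rw [h]; exact z.2
    rw [frobE'_inflateE'] at hz'
    obtain ⟨hl, hz''⟩ := inflateE'_injective hC
      (by rw [projG_frob, hl₁, map_one]) (by rw [projG_frob, hl₂, map_one]) hl₁ hl₂ hz'
    exact ⟨((⟨⟨l.1, congrArg Prod.fst hl⟩, hl₁⟩, ⟨⟨l.2, congrArg Prod.snd hl⟩, hl₂⟩), ⟨z', hz''⟩),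
      Subtype.ext h⟩
  have hinner : ∀ w, pushforward (fixMap p₂ (p₂_semiconj φ))
      (fun z => F₁ (fixMap p₁T (p₁T_semiconj φ) z) * F₂ (fixMap p₁W (p₁W_semiconj φ) z)) (n w) =
      Nat.card (KerF hC φ τ × KerF hC φ ω) * (c₁ * c₂) *
        pushforward (fixMap p₂ (p₂_semiconj φ)) (fun z => f₁ (fixMap p₁T (p₁T_semiconj φ) z) *
          f₂ (fixMap p₁W (p₁W_semiconj φ) z)) w := fun w => by
    refine pushforward_eq_mul m n _ hm hn hp (fun z => ?_) w (fun z hz => ?_)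
    · rw [h₁ (fixMap p₁T (p₁T_semiconj φ) (m z)) (fixMap p₁T (p₁T_semiconj φ) z.2),
        h₂ (fixMap p₁W (p₁W_semiconj φ) (m z)) (fixMap p₁W (p₁W_semiconj φ) z.2)]
      · ring
      · show p₁W (inflateE' hC _ _) ∈ _
        rw [p₁W_inflateE']
        exact smul_mem_heart _ (inflate_mem_heart hC _)
      · show contractMap hC (p₁W (inflateE' hC _ _)) = _
        rw [p₁W_inflateE']
        exact contractMap_inv_smul_inflate hC z.1.2.2 _
      · show p₁T (inflateE' hC _ _) ∈ _
        rw [p₁T_inflateE']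
        exact smul_mem_heart _ (inflate_mem_heart hC _)
      · show contractMap hC (p₁T (inflateE' hC _ _)) = _
        rw [p₁T_inflateE']
        exact contractMap_inv_smul_inflate hC z.1.1.2 _
    · refine hsurj z (p₃ w.1) ?_
      rw [← p₃_inflateE'']
      exact congrArg p₃ (congrArg Subtype.val hz)
  -- For `p₃` the fibres correspond bijectively, so the parameter set is a point and the inner
  -- factor is the constant `c`.
  have := pushforward_eq_mul (L := Unit) (f := fixMap p₃ (p₃_semiconj φ))
    (f' := fixMap p₃ (p₃_semiconj φ)) (fun z => n z.2) (inflateF hC φ) _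
    (fun z z' h => Prod.ext rfl (hn h))
    (fun x x' h => Subtype.ext (inflateSum_injective hC (congrArg Subtype.val h)))
    (fun z => Subtype.ext (p₃_inflateE'' hC _)) (fun z => hinner z.2) x (fun w hw => by
      -- An arbitrary lift to `E'`, not necessarily `F`-fixed, is enough: only its image in `E''` is
      -- used, and `F`-invariance of the preimage follows from injectivity of `inflateE''`.
      obtain ⟨⟨z, hz⟩⟩ : Nonempty {z : EPrime (Q := Q) K (extDim hC τ) (extDim hC ω) //
        p₂ z = w.1} := by
        obtain ⟨⟨w⟩, _⟩ := w
        exact ⟨⟨Quotient.mk _ w, rfl⟩⟩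
      have hw' : p₃ w.1 = inflateSum hC x.1 := congrArg Subtype.val hw
      obtain ⟨l, z', hl₁, hl₂, h⟩ := exists_inflateE' hC (z := z) (by rw [hz]; exact hw')
      have h' : inflateE'' hC (p₂ z') = w.1 := by rw [← p₂_inflateE', h, hz]
      refine ⟨((), ⟨p₂ z', inflateE''_injective hC ?_⟩), Subtype.ext h'⟩
      rw [← frobE''_inflateE'', h']
      exact w.2)
  rw [Nat.card_unique, Nat.cast_one, one_mul] at this
  exact this

/-- A nonzero term would come from some `y` with both parts in the loci where the `h_k` are
invertible. Then each `y_{h_k}` is block triangular with invertible diagonal blocks, so `x = g.y`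
would lie in `E_V^♡`. -/
theorem rawInd_eq_zero {F₁ : RepF (Q := Q) φ (extDim hC τ) → R}
    {F₂ : RepF (Q := Q) φ (extDim hC ω) → R} (h₁ : ∀ y, y.1 ∉ heart e (extDim hC τ) → F₁ y = 0)
    (h₂ : ∀ y, y.1 ∉ heart e (extDim hC ω) → F₂ y = 0)
    {x : RepF (Q := Q) φ (extDim hC τ + extDim hC ω)}
    (hx : x.1 ∉ heart e (extDim hC τ + extDim hC ω)) : rawInd φ F₁ F₂ x = 0 := by
  refine finsum_eq_zero_of_forall_eq_zero fun w =>
    finsum_eq_zero_of_forall_eq_zero fun z => ?_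
  have hz : p₃ (p₂ z.1.1) = x.1 := by
    have h1 : p₂ z.1.1 = w.1.1 := congrArg Subtype.val z.2
    rw [h1]
    exact congrArg Subtype.val w.2
  by_contra hne
  apply hx
  have hT : p₁T z.1.1 ∈ heart e (extDim hC τ) := by
    by_contra h
    exact hne (by dsimp only; rw [h₁ (fixMap p₁T (p₁T_semiconj φ) z.1) h, zero_mul])
  have hW : p₁W z.1.1 ∈ heart e (extDim hC ω) := by
    by_contra h
    exact hne (by dsimp only; rw [h₂ (fixMap p₁W (p₁W_semiconj φ) z.1) h, mul_zero])
  rw [← hz]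
  revert hT hW
  generalize z.1.1 = z
  obtain ⟨g, y⟩ := z
  intro hT hW
  refine smul_mem_heart g fun h hh => ?_
  exact (y.2 h).bijective (extDim_tgt_eq_src hC τ hh) (extDim_tgt_eq_src hC ω hh)
    (hT h hh) (hW h hh)

/-! ### Comparison of the exponents `m_Ω` -/

theorem finsum_vertices (f : Q.CVertex e → ℕ) :
    ∑ᶠ i : ι, f (fold hC i) = ∑ᶠ i, f i +
      ∑ᶠ i : {i // i ∈ Q.orbit (Q.tgt e)}, f (fold hC i.1) := by
  classical
  have := Fintype.ofFinite ι
  rw [finsum_eq_sum_of_fintype, finsum_eq_sum_of_fintype, finsum_eq_sum_of_fintype,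
    ← Fintype.sum_subtype_add_sum_subtype (fun i => i ∉ Q.orbit (Q.tgt e))]
  congr 1
  · exact Finset.sum_congr rfl fun i _ => by rw [fold_eq]
  · exact Fintype.sum_equiv (Equiv.subtypeEquivRight fun i => not_not) _ _ fun i => rfl

theorem fold_orb {i : ι} (hi : i ∈ Q.orbit (Q.tgt e)) :
    (contract hC).orb (fold hC i) = (contract hC).orb (fold hC (Q.tgt e)) := by
  have h : Q.orb i = Q.orb (Q.tgt e) := Quotient.sound hi.symm
  exact congrArg (foldOrb hC) h

theorem card_sameCycle (hC : Q.IsContractible e) :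
    Nat.card {h : Ω // Q.aE.SameCycle e h} = Q.φ₁ (Q.tgt e) := by
  refine Nat.card_congr (Equiv.ofBijective (fun h => ⟨Q.tgt h.1, tgt_mem h.2⟩) ⟨?_, ?_⟩)
  · exact fun h h' heq => Subtype.ext (hC.eq_of_tgt h.2 h'.2 (congrArg Subtype.val heq))
  · exact fun i => ⟨⟨Q.leg e i.2, Q.leg_sameCycle e i.2⟩, Subtype.ext (Q.tgt_leg e i.2)⟩

/-- Undoing the contraction adds the vertices of `[i₋]` and the edges `h_k`. There are `φ₁(i₋)` of
each, and each one contributes the same product of dimensions. -/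
theorem mExp_extDim : mExp (extDim hC τ) (extDim hC ω) = mExp τ ω +
    2 * (Q.φ₁ (Q.tgt e) * (extDim hC τ (Q.orb (Q.tgt e)) * extDim hC ω (Q.orb (Q.tgt e)))) := by
  classical
  have := Fintype.ofFinite ι
  have := Fintype.ofFinite Ω
  have hV : ∑ᶠ i : ι, extDim hC τ (Q.orb i) * extDim hC ω (Q.orb i) =
      ∑ᶠ i, τ ((contract hC).orb i) * ω ((contract hC).orb i) +
      Q.φ₁ (Q.tgt e) * (extDim hC τ (Q.orb (Q.tgt e)) * extDim hC ω (Q.orb (Q.tgt e))) := by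
    refine (finsum_vertices hC fun i => τ ((contract hC).orb i) * ω ((contract hC).orb i)).trans ?_
    congr 1
    refine (finsum_congr fun i => (?_ : _ = extDim hC τ (Q.orb (Q.tgt e)) *
      extDim hC ω (Q.orb (Q.tgt e)))).trans ?_
    · rw [fold_orb hC i.2, extDim_orb, extDim_orb]
    · rw [finsum_eq_sum_of_fintype, Finset.sum_const, smul_eq_mul, Finset.card_univ, φ₁,
        Nat.card_eq_fintype_card]
  have hE : ∑ᶠ h : Ω, extDim hC τ (Q.orb (Q.src h)) * extDim hC ω (Q.orb (Q.tgt h)) =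
      ∑ᶠ h : Q.CEdge e, τ ((contract hC).orb ((contract hC).src h)) *
        ω ((contract hC).orb ((contract hC).tgt h)) +
      Q.φ₁ (Q.tgt e) * (extDim hC τ (Q.orb (Q.tgt e)) * extDim hC ω (Q.orb (Q.tgt e))) := by
    rw [finsum_eq_sum_of_fintype, finsum_eq_sum_of_fintype,
      ← Fintype.sum_subtype_add_sum_subtype (fun h => Q.aE.SameCycle e h), add_comm]
    congr 1
    refine (Finset.sum_congr rfl fun h _ => (?_ : _ = extDim hC τ (Q.orb (Q.tgt e)) *
      extDim hC ω (Q.orb (Q.tgt e)))).trans ?_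
    · have h1 : Q.orb (Q.tgt h.1) = Q.orb (Q.tgt e) := Quotient.sound (tgt_mem h.2).symm
      rw [← extDim_tgt_eq_src hC τ h.2, h1]
    · rw [Finset.sum_const, smul_eq_mul, Finset.card_univ, ← Nat.card_eq_fintype_card,
        card_sameCycle hC]
  rw [mExp, mExp, hV, hE]
  ring

end compare

/-! ### Finiteness of `G_V^F` -/

section finiteness

variable {ι Ω : Type*} {Q : AdmissibleQuiver ι Ω} {K : Type*} [Field K]

theorem orb_pow_aV (k : ℕ) (i : ι) : Q.orb ((Q.aV ^ k) i) = Q.orb i := by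
  induction k with
  | zero => rfl
  | succ k ih => rw [pow_succ', Equiv.Perm.mul_apply, orb_aV, ih]

/-- This iterates the fixed-point equation `g_i = φ(g_{a(i)})`. When `k` is the order of `a`, it
says that all entries of `g` are fixed by a power of `φ`. -/
theorem frobG_pow_apply (φ : K →+* K) {ν : Q.Dim} {g : Q.Grp K ν} (hg : frobG φ g = g) (k : ℕ)
    {i j : ι} (hij : (Q.aV ^ k) i = j) (h : ν (Q.orb i) = ν (Q.orb j)) :
    (g i).1 = castM h h ((g j).1.map (φ ^ k)) := by
  induction k generalizing j with
  | zero =>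
    subst hij
    rfl
  | succ k ih =>
    subst hij
    rw [ih rfl (by rw [orb_pow_aV])]
    have h1 := congrArg Units.val (congrFun hg ((Q.aV ^ k) i))
    rw [frobG_apply] at h1
    rw [← h1, castM_map, castM_castM, Matrix.map_map]
    have h2 : ((φ ^ k : K →+* K) : K → K) ∘ φ = (φ ^ (k + 1) : K →+* K) := by
      rw [pow_succ]; rfl
    rw [h2]
    exact castM_family (fun i => (g i).1.map (φ ^ (k + 1)))
      (by rw [pow_succ', Equiv.Perm.mul_apply]) _ _ _ _

theorem finite_grpF [Finite ι] (φ : K →+* K)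
    (hφ : ∀ d : ℕ, 0 < d → {x : K | (φ ^ d) x = x}.Finite) (ν : Q.Dim) :
    Finite (GrpF (Q := Q) φ ν) := by
  have := Fintype.ofFinite ι
  have hd : 0 < orderOf Q.aV := orderOf_pos _
  have := (hφ _ hd).to_subtype
  let S := {x : K | (φ ^ orderOf Q.aV) x = x}
  let f : GrpF (Q := Q) φ ν → ∀ i : ι, Fin (ν (Q.orb i)) → Fin (ν (Q.orb i)) → S :=
    fun g i r c => ⟨(g.1 i).1 r c, by
      have := frobG_pow_apply φ g.2 (orderOf Q.aV) (i := i) (j := i)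
        (by rw [pow_orderOf_eq_one, Equiv.Perm.one_apply]) rfl
      exact (congrFun (congrFun this r) c).symm⟩
  refine Finite.of_injective f fun g g' h => Subtype.ext (funext fun i => Units.ext ?_)
  ext r c
  exact congrArg Subtype.val (congrFun (congrFun (congrFun h i) r) c)

end finiteness

/-- The fixed points are roots of `X^(p^(nd)) - X`, which is nonzero because `nd > 0`. -/
theorem finite_fixed_Fr (p : ℕ) [Fact p.Prime] {n : ℕ} (hn : 0 < n) (d : ℕ) (hd : 0 < d) :
    {x : AlgebraicClosure (ZMod p) | (Fr p n ^ d) x = x}.Finite := by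
  have hp : 1 < p := (Fact.out : p.Prime).one_lt
  have h0 : (Polynomial.X ^ p ^ (n * d) - Polynomial.X :
      Polynomial (AlgebraicClosure (ZMod p))) ≠ 0 :=
    FiniteField.X_pow_card_pow_sub_X_ne_zero _ (Nat.mul_pos hn hd).ne' hp
  refine (Polynomial.finite_setOfPred_isRoot h0).subset fun x hx => ?_
  have h1 : (Fr p n ^ d) x = x ^ p ^ (n * d) := by
    rw [Fr, iterateFrobenius_eq_pow, ← pow_mul, ← iterateFrobenius_eq_pow, iterateFrobenius_def]
  have h2 : x ^ p ^ (n * d) = x := h1.symm.trans hx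
  simp [Polynomial.IsRoot, h2]

/-! ### The homomorphism `ψ` -/

section homomorphism

variable {ι Ω : Type*} {Q : AdmissibleQuiver ι Ω} [Finite ι] [Finite Ω] {e : Ω}
variable (hC : Q.IsContractible e) {K : Type*} [Field K] (φ : K →+* K)
variable {R : Type*} [Field R] (s : R)

/-- The component `H_ν̂ → H_ν` of `ψ`. -/
def psiHom (ν : (contract hC).Dim) :
    hallSpace (Q := contract hC) φ R ν →ₗ[R] hallSpace (Q := Q) φ R (extDim hC ν) :=
  jShriek hC φ R ν ∘ₗ muStar hC φ s ν

theorem psiHom_of_mem {ν : (contract hC).Dim} (f : hallSpace (Q := contract hC) φ R ν)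
    {x : RepF (Q := Q) φ (extDim hC ν)} (hx : x.1 ∈ heart e (extDim hC ν)) :
    (psiHom hC φ s ν f).1 x =
      s⁻¹ ^ (extDim hC ν (Q.orb (Q.tgt e)) ^ 2 * Q.φ₁ (Q.tgt e)) * f.1 (mu hC φ ν ⟨x, hx⟩) :=
  dif_pos hx

/-- This is the form of the value of `ψ` that the hypotheses of `rawInd_inflateF` ask for. -/
theorem psiHom_of_contractMap_eq {ν : (contract hC).Dim}
    (f : hallSpace (Q := contract hC) φ R ν) (x : RepF (Q := Q) φ (extDim hC ν))
    (x' : RepF (Q := contract hC) φ ν) (hx : x.1 ∈ heart e (extDim hC ν))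
    (hxx : contractMap hC x.1 = x'.1) : (psiHom hC φ s ν f).1 x =
      s⁻¹ ^ (extDim hC ν (Q.orb (Q.tgt e)) ^ 2 * Q.φ₁ (Q.tgt e)) * f.1 x' := by
  rw [psiHom_of_mem hC φ s f hx, show mu hC φ ν ⟨x, hx⟩ = x' from Subtype.ext hxx]

theorem psiHom_of_notMem {ν : (contract hC).Dim} (f : hallSpace (Q := contract hC) φ R ν)
    {x : RepF (Q := Q) φ (extDim hC ν)} (hx : x.1 ∉ heart e (extDim hC ν)) :
    (psiHom hC φ s ν f).1 x = 0 :=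
  dif_neg hx

/-- At the inflation of `x` the value of `ψ(f)` is a nonzero multiple of `f(x)`. -/
theorem psiHom_injective (hs : s ≠ 0) (ν : (contract hC).Dim) :
    Function.Injective (psiHom hC φ s ν) := by
  intro f g h
  refine Subtype.ext (funext fun x => ?_)
  have hx := inflate_mem_heart hC x.1
  have hxx := contractMap_inflate hC x.1
  let y : RepF (Q := Q) φ (extDim hC ν) := fixMap (inflate hC) (inflate_frob hC φ) x
  have hf := psiHom_of_contractMap_eq hC φ s f y x hx hxx
  have hg := psiHom_of_contractMap_eq hC φ s g y x hx hxx
  rw [h] at hf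
  exact mul_left_cancel₀ (pow_ne_zero _ (inv_ne_zero hs)) (hf.symm.trans hg)

theorem ind_apply {τ ω : Q.Dim} (f₁ : hallSpace (Q := Q) φ R τ) (f₂ : hallSpace (Q := Q) φ R ω)
    (x : RepF (Q := Q) φ (τ + ω)) : (ind φ s f₁ f₂).1 x = (s ^ mExp τ ω)⁻¹ *
      (Nat.card (GrpF (Q := Q) φ τ × GrpF (Q := Q) φ ω) : R)⁻¹ * rawInd φ f₁.1 f₂.1 x := rfl

theorem psiHom_ind [CharZero R] (hs : s ≠ 0) [∀ ν, Finite (GrpF (Q := Q) φ ν)]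
    {τ ω : (contract hC).Dim} (f : hallSpace (Q := contract hC) φ R τ)
    (g : hallSpace (Q := contract hC) φ R ω) :
    psiHom hC φ s (τ + ω) (ind φ s f g) = ind φ s (psiHom hC φ s τ f) (psiHom hC φ s ω g) := by
  refine Subtype.ext (funext fun x => ?_)
  refine Eq.trans ?_ (ind_apply φ s (psiHom hC φ s τ f) (psiHom hC φ s ω g) x).symm
  by_cases hx : x.1 ∈ heart e (extDim hC (τ + ω))
  · rw [psiHom_of_mem hC φ s _ hx, ind_apply]
    obtain ⟨t, ht, htF⟩ := exists_smul_inflate hC φ hx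
    -- Invariance under `t` moves the evaluation from `x` to the inflation of its contraction.
    have h1 := rawInd_mem φ (psiHom hC φ s τ f).1 (psiHom hC φ s ω g).1 ⟨t, htF x.2⟩
      (inflateF hC φ (mu hC φ (τ + ω) ⟨x, hx⟩)) x ht
    have h2 := rawInd_inflateF hC φ _ _ (psiHom_of_contractMap_eq hC φ s f)
      (psiHom_of_contractMap_eq hC φ s g) (mu hC φ (τ + ω) ⟨x, hx⟩)
    rw [h1, h2, mExp_extDim]
    generalize rawInd φ f.1 g.1 (mu hC φ (τ + ω) ⟨x, hx⟩) = r
    rw [show extDim hC (τ + ω) (Q.orb (Q.tgt e)) =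
      extDim hC τ (Q.orb (Q.tgt e)) + extDim hC ω (Q.orb (Q.tgt e)) from rfl]
    generalize extDim hC τ (Q.orb (Q.tgt e)) = a
    generalize extDim hC ω (Q.orb (Q.tgt e)) = b
    generalize Q.φ₁ (Q.tgt e) = c
    have hT := Nat.card_congr (grpFEquiv hC φ τ)
    have hW := Nat.card_congr (grpFEquiv hC φ ω)
    have hT0 : Nat.card (GrpF (Q := Q) φ (extDim hC τ)) ≠ 0 :=
      Nat.card_ne_zero.2 ⟨⟨⟨1, map_one (frobG φ)⟩⟩, inferInstance⟩
    have hW0 : Nat.card (GrpF (Q := Q) φ (extDim hC ω)) ≠ 0 :=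
      Nat.card_ne_zero.2 ⟨⟨⟨1, map_one (frobG φ)⟩⟩, inferInstance⟩
    rw [Nat.card_prod] at hT hW
    rw [Nat.card_prod, Nat.card_prod, Nat.card_prod, hT, hW]
    rw [hT] at hT0
    rw [hW] at hW0
    generalize Nat.card (KerF hC φ τ) = k₁ at *
    generalize Nat.card (KerF hC φ ω) = k₂ at *
    generalize Nat.card (GrpF (Q := contract hC) φ τ) = n₁ at *
    generalize Nat.card (GrpF (Q := contract hC) φ ω) = n₂ at *
    generalize mExp τ ω = m
    have hn₁ : (n₁ : R) ≠ 0 := Nat.cast_ne_zero.2 (left_ne_zero_of_mul hT0)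
    have hn₂ : (n₂ : R) ≠ 0 := Nat.cast_ne_zero.2 (left_ne_zero_of_mul hW0)
    have hk₁ : (k₁ : R) ≠ 0 := Nat.cast_ne_zero.2 (right_ne_zero_of_mul hT0)
    have hk₂ : (k₂ : R) ≠ 0 := Nat.cast_ne_zero.2 (right_ne_zero_of_mul hW0)
    -- Only scalars remain: the orders `k₁`, `k₂` of the kernels cancel, and the powers of `s` agree
    -- because `(a + b)² c = a² c + b² c + 2cab`.
    push_cast
    rw [inv_pow, inv_pow, inv_pow]
    field_simp
    ring
  · rw [psiHom_of_notMem hC φ s _ hx]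
    have h0 := rawInd_eq_zero hC φ (F₁ := (psiHom hC φ s τ f).1) (F₂ := (psiHom hC φ s ω g).1)
      (fun y hy => psiHom_of_notMem hC φ s f hy) (fun y hy => psiHom_of_notMem hC φ s g hy) hx
    rw [h0, mul_zero]

/-! ### From homogeneous components to the direct sums -/

theorem hallAlgebra_induction {p : Q.HallAlgebra φ s → Prop} (f : Q.HallAlgebra φ s) (h0 : p 0)
    (hof : ∀ ν x, p (Q.hallOf φ s ν x)) (hadd : ∀ x y, p x → p y → p (x + y)) : p f := by
  classical
  exact DirectSum.induction_on (motive := p) f h0 hof hadd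

theorem hallComponent_hallOf_self (ν : Q.Dim) (x : hallSpace (Q := Q) φ R ν) :
    Q.hallComponent φ s ν (Q.hallOf φ s ν x) = x := by
  classical
  exact DirectSum.component.lof_self R (M := fun ν => hallSpace (Q := Q) φ R ν) ν x

theorem hallComponent_hallOf_of_ne {ν ν' : Q.Dim} (h : ν ≠ ν')
    (x : hallSpace (Q := Q) φ R ν) : Q.hallComponent φ s ν' (Q.hallOf φ s ν x) = 0 := by
  classical
  exact (DirectSum.component.of R (M := fun ν => hallSpace (Q := Q) φ R ν) ν' ν x).trans (dif_neg h)

theorem hallAlgebra_ext {f g : Q.HallAlgebra φ s}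
    (h : ∀ ν, Q.hallComponent φ s ν f = Q.hallComponent φ s ν g) : f = g :=
  DFinsupp.ext h

theorem mem_hallSupport {f : Q.HallAlgebra φ s} {ν : Q.Dim} :
    ν ∈ Q.hallSupport φ s f ↔ Q.hallComponent φ s ν f ≠ 0 := by
  classical
  exact DFinsupp.mem_support_iff

theorem psi_hallOf (ν : (contract hC).Dim) (f : hallSpace (Q := contract hC) φ R ν) :
    psi hC φ s ((contract hC).hallOf φ s ν f) =
      Q.hallOf φ s (extDim hC ν) (psiHom hC φ s ν f) := by
  classical
  have h1 : muStarHall hC φ s ((contract hC).hallOf φ s ν f) =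
      DirectSum.lof R _ (fun ν => heartSpace hC φ R ν) ν (muStar hC φ s ν f) :=
    DirectSum.lmap_lof (fun ν => muStar hC φ s ν) ν f
  rw [psi, LinearMap.comp_apply, h1]
  exact DirectSum.toModule_lof R ν _

/-- Every orbit of the contracted graph has a representative outside `[i₋]`, where `extDim` reads
off the original value. -/
theorem extDim_injective : Function.Injective (extDim hC) := fun ν ν' h => by
  funext i
  obtain ⟨i, rfl⟩ := Quotient.exists_rep i
  have := congrFun h (Q.orb i.1)
  rwa [← extDim_val, ← extDim_val] at this

theorem hallComponent_psi (ν : (contract hC).Dim) (f : (contract hC).HallAlgebra φ s) :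
    Q.hallComponent φ s (extDim hC ν) (psi hC φ s f) =
      psiHom hC φ s ν ((contract hC).hallComponent φ s ν f) := by
  refine hallAlgebra_induction φ s (p := fun f => Q.hallComponent φ s (extDim hC ν) (psi hC φ s f) =
    psiHom hC φ s ν ((contract hC).hallComponent φ s ν f)) f (by simp) (fun ν' x => ?_)
    fun x y hx hy => by simp only [map_add, hx, hy]
  rw [psi_hallOf]
  by_cases h : ν' = ν
  · subst h
    rw [hallComponent_hallOf_self, hallComponent_hallOf_self]
  · rw [hallComponent_hallOf_of_ne φ s h, map_zero,
      hallComponent_hallOf_of_ne φ s (fun h' => h (extDim_injective hC h'))]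

theorem hallComponent_psi_of_notMem {ν : Q.Dim} (hν : ν ∉ Set.range (extDim hC))
    (f : (contract hC).HallAlgebra φ s) : Q.hallComponent φ s ν (psi hC φ s f) = 0 := by
  refine hallAlgebra_induction φ s (p := fun f => Q.hallComponent φ s ν (psi hC φ s f) = 0) f
    (by simp) (fun ν' x => ?_) fun x y hx hy => by simp only [map_add, hx, hy, add_zero]
  rw [psi_hallOf, hallComponent_hallOf_of_ne φ s (fun h => hν ⟨ν', h⟩)]

theorem psi_injective (hs : s ≠ 0) : Function.Injective (psi hC φ s) := fun f g h =>
  hallAlgebra_ext φ s fun ν => psiHom_injective hC φ s hs ν (by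
    rw [← hallComponent_psi, ← hallComponent_psi, h])

theorem psi_one : psi hC φ s 1 = 1 := by
  refine (psi_hallOf hC φ s 0 _).trans (congrArg (Q.hallOf φ s 0) (Subtype.ext (funext fun x => ?_)))
  refine (psiHom_of_mem hC φ s _ (x := x) fun h _ => ?_).trans ?_
  -- In dimension zero every map is an isomorphism, so the only point lies in `E_V^♡`.
  · have : Subsingleton (Fin (extDim hC 0 (Q.orb (Q.src h))) → K) :=
      inferInstanceAs (Subsingleton (Fin 0 → K))
    have : Subsingleton (Fin (extDim hC 0 (Q.orb (Q.tgt h))) → K) :=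
      inferInstanceAs (Subsingleton (Fin 0 → K))
    exact ⟨Function.injective_of_subsingleton _, fun v => ⟨0, Subsingleton.elim _ _⟩⟩
  · have : extDim hC 0 (Q.orb (Q.tgt e)) = 0 := rfl
    rw [this]
    simp

theorem ind_zero_left {τ ω : Q.Dim} (g : hallSpace (Q := Q) φ R ω) :
    ind φ s (0 : hallSpace (Q := Q) φ R τ) g = 0 := Subtype.ext <| funext fun x => by
  have h : rawInd φ (0 : hallSpace (Q := Q) φ R τ).1 g.1 x = 0 :=
    finsum_eq_zero_of_forall_eq_zero fun _ => finsum_eq_zero_of_forall_eq_zero fun _ =>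
      zero_mul _
  rw [ind_apply, h, mul_zero]
  rfl

theorem ind_zero_right {τ ω : Q.Dim} (f : hallSpace (Q := Q) φ R τ) :
    ind φ s f (0 : hallSpace (Q := Q) φ R ω) = 0 := Subtype.ext <| funext fun x => by
  have h : rawInd φ f.1 (0 : hallSpace (Q := Q) φ R ω).1 x = 0 :=
    finsum_eq_zero_of_forall_eq_zero fun _ => finsum_eq_zero_of_forall_eq_zero fun _ =>
      mul_zero _
  rw [ind_apply, h, mul_zero]
  rfl

theorem hallAlgebra_mul_def (f g : Q.HallAlgebra φ s) :
    f * g = ∑ τ ∈ Q.hallSupport φ s f, ∑ ω ∈ Q.hallSupport φ s g,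
      Q.hallOf φ s (τ + ω) (ind φ s (Q.hallComponent φ s τ f) (Q.hallComponent φ s ω g)) := rfl

/-- The product may be summed over larger index sets because induction with a zero factor is zero.
The support of `ψ(f)` is only bounded above, by the image of the support of `f`, and this image is
the convenient index set in `psi_mul`. -/
theorem mul_eq_sum {f g : Q.HallAlgebra φ s} {S T : Finset Q.Dim}
    (hS : Q.hallSupport φ s f ⊆ S) (hT : Q.hallSupport φ s g ⊆ T) :
    f * g = ∑ τ ∈ S, ∑ ω ∈ T,
      Q.hallOf φ s (τ + ω) (ind φ s (Q.hallComponent φ s τ f) (Q.hallComponent φ s ω g)) := by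
  rw [hallAlgebra_mul_def]
  refine Eq.trans (Finset.sum_congr rfl fun τ _ => Finset.sum_subset hT fun ω _ hω => ?_)
    (Finset.sum_subset hS fun τ _ hτ => Finset.sum_eq_zero fun ω _ => ?_)
  · rw [mem_hallSupport, not_not] at hω
    rw [hω, ind_zero_right, map_zero]
  · rw [mem_hallSupport, not_not] at hτ
    rw [hτ, ind_zero_left, map_zero]

open Classical in
theorem hallSupport_psi_subset (f : (contract hC).HallAlgebra φ s) :
    Q.hallSupport φ s (psi hC φ s f) ⊆
      ((contract hC).hallSupport φ s f).image (extDim hC) := fun ν hν => by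
  rw [mem_hallSupport] at hν
  by_cases h : ν ∈ Set.range (extDim hC)
  · obtain ⟨ν, rfl⟩ := h
    refine Finset.mem_image_of_mem _ ((mem_hallSupport φ s).2 fun h0 => hν ?_)
    rw [hallComponent_psi, h0, map_zero]
  · exact absurd (hallComponent_psi_of_notMem hC φ s h f) hν

theorem psi_mul [CharZero R] (hs : s ≠ 0) [∀ ν, Finite (GrpF (Q := Q) φ ν)]
    (f g : (contract hC).HallAlgebra φ s) :
    psi hC φ s (f * g) = psi hC φ s f * psi hC φ s g := by
  classical
  rw [mul_eq_sum φ s (hallSupport_psi_subset hC φ s f) (hallSupport_psi_subset hC φ s g),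
    Finset.sum_image (extDim_injective hC).injOn, hallAlgebra_mul_def, map_sum]
  refine Finset.sum_congr rfl fun τ _ => ?_
  rw [Finset.sum_image (extDim_injective hC).injOn, map_sum]
  refine Finset.sum_congr rfl fun ω _ => ?_
  rw [psi_hallOf, hallComponent_psi, hallComponent_psi]
  exact congrArg (Q.hallOf φ s (extDim hC τ + extDim hC ω)) (psiHom_ind hC φ s hs _ _)

end homomorphism

end AdmissibleQuiver

end HallContraction

end

/-! ### The theorem over `ℚ(q^{1/2})` -/

theorem mainTheorem1 {ι Ω : Type*} [Finite ι] [Finite Ω]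
    (Q : HallContraction.AdmissibleQuiver ι Ω) (e : Ω) (hC : Q.IsContractible e)
    (p : ℕ) [Fact p.Prime] (n : ℕ) (hn : 0 < n) (s : ℂ) (hs : s ^ 2 = (p : ℂ) ^ n) :
    Function.Injective (HallContraction.AdmissibleQuiver.psi hC (HallContraction.Fr p n)
      (HallContraction.root s)) ∧
    HallContraction.AdmissibleQuiver.psi hC (HallContraction.Fr p n) (HallContraction.root s) 1 = 1 ∧
    ∀ f g : (HallContraction.AdmissibleQuiver.contract hC).HallAlgebra (HallContraction.Fr p n)
        (HallContraction.root s),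
      HallContraction.AdmissibleQuiver.psi hC (HallContraction.Fr p n) (HallContraction.root s)
          (f * g) =
        HallContraction.AdmissibleQuiver.psi hC (HallContraction.Fr p n) (HallContraction.root s) f *
        HallContraction.AdmissibleQuiver.psi hC (HallContraction.Fr p n) (HallContraction.root s) g
    := by
  -- Of the equation `s² = q`, the argument needs only that `s` is nonzero. The other arithmetic
  -- input is the finiteness of the groups `G_V^F`.
  have h0 : HallContraction.root s ≠ 0 := fun h => by
    have h1 : s = 0 := by
      rw [← IntermediateField.AdjoinSimple.algebraMap_gen ℚ s]
      exact (congrArg _ h).trans (map_zero _)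
    rw [h1, zero_pow two_ne_zero] at hs
    exact pow_ne_zero n (Nat.cast_ne_zero.2 (Fact.out : p.Prime).ne_zero) hs.symm
  have := HallContraction.AdmissibleQuiver.finite_grpF (Q := Q) (HallContraction.Fr p n)
    (HallContraction.AdmissibleQuiver.finite_fixed_Fr p hn)
  exact ⟨HallContraction.AdmissibleQuiver.psi_injective hC _ _ h0,
    HallContraction.AdmissibleQuiver.psi_one hC _ _,
    HallContraction.AdmissibleQuiver.psi_mul hC _ _ h0⟩
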